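/- Let $(\overline M,\overline g)$ be a semi-Riemannian manifold (a smooth manifold with a smooth symmetric nondegenerate $(0,2)$-tensor field of constant index) of constant sectional curvature $c$, with Levi-Civita connection $\overline\nabla$. Let $M$ be an (immersed) lightlike hypersurface of $\overline M$, i.e. a smooth immersed submanifold of codimension one whose induced metric $g$ is degenerate at every point; its radical $\mathrm{Rad}\,TM=TM\cap TM^\perp$ is then a line bundle. A screen distribution is a smooth distribution $S(TM)$ with $TM=\mathrm{Rad}\,TM\oplus S(TM)$. For a nonzero $\xi\in\mathrm{Rad}\,T_uM$ there is a unique $N\in T_u\overline M$ with $\overline g(\xi,N)=1$, $\overline g(N,N)=0$, $N\perp S(T_uM)$; these $N$ span the line bundle $\mathrm{ltr}(TM)$, and $T\overline M|_M=TM\oplus \mathrm{ltr}(TM)$. The induced connection $\nabla$ on $M$ is defined by letting $\nabla_XY$ be the $TM$-component of $\overline\nabla_XY$. Let $R(X,Y)=\nabla_X\nabla_Y-\nabla_Y\nabla_X-\nabla_{[X,Y]}$ be its curvature, $R(X,Y,Z,W)=g(R(X,Y)Z,W)$, and $Ric(X,Y)=\mathrm{tr}(Z\mapsto R(Z,X)Y)$.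 The screen $S(TM)$ is called admissible if $R(\cdot,\cdot,\cdot,\cdot)$ is an algebraic curvature tensor at every point, i.e. $R(x,y,z,w)=-R(y,x,z,w)=R(z,w,x,y)$ and $R(x,y,z,w)+R(y,z,x,w)+R(z,x,y,w)=0$. For a pair $\{\xi,N\}$ as above put $\eta=\overline g(\cdot,N)$ and $\tilde g=g+\eta\otimes\eta$, a nondegenerate form on $T_uM$. For an admissible screen the pseudo-Jacobi operator $J_R(x)$ on $T_uM$ is defined by $\tilde g(J_R(x)y,w)=R(y,x,x,w)$. $M$ is called spacelike (resp. timelike) Osserman at $u$ if for each admissible screen distribution the characteristic polynomial of $J_R(x)$ is the same for all $x\in T_uM$ with $g(x,x)=1$ (resp. $g(x,x)=-1$). $M$ is called Osserman at $u$ if it is spacelike Osserman at $u$ and unit spacelike vectors exist in $T_uM$, or it is timelike Osserman at $u$ and unit timelike vectors exist in $T_uM$, or $T_uM$ has no unit vectors of either kind ($\dim M=1$). $M$ is pointwise Osserman if it is Osserman at each of its points. **Theorem.** If $M$ is pointwise Osserman, then for every admissible screen distribution $S(TM)$ the lightlike hypersurface $(M,g,S(TM))$ is Ricci semi-symmetric: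 $R\cdot Ric=0$, that is, $$(R(V_1,V_2)\cdot Ric)(X,Y)=-Ric(R(V_1,V_2)X,Y)-Ric(X,R(V_1,V_2)Y)=0$$ for all $u\in M$ and $V_1,V_2,X,Y\in T_uM$. -/

import Mathlib

set_option maxSynthPendingDepth 3

open Manifold ContDiff Topology

noncomputable section

namespace LightlikeOsserman

/-! ## Pointwise linear algebra -/

section PointwiseAlgebra

variable {V : Type*} [AddCommGroup V] [Module ℝ V]

/-- `R` is a curvature-like operator on a vector space carrying a (possibly degenerate) symmetric
form `b`. The predicate says that the `(0,4)`-tensor `R(x,y,z,w) = b(R(x,y)z, w)` is an algebraic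
curvature tensor. -/
structure IsAlgebraicCurvature (b : LinearMap.BilinForm ℝ V)
    (R : V →ₗ[ℝ] V →ₗ[ℝ] V →ₗ[ℝ] V) : Prop where
  antisymm : ∀ x y z w, b (R x y z) w = -b (R y x z) w
  pair_symm : ∀ x y z w, b (R x y z) w = b (R z w x) y
  bianchi : ∀ x y z w, b (R x y z) w + b (R y z x) w + b (R z x y) w = 0

/-- The Ricci tensor of `R`: `Ric(X, Y)` is the trace of `Z ↦ R(Z, X)Y`. -/
def ricci (R : V →ₗ[ℝ] V →ₗ[ℝ] V →ₗ[ℝ] V) (X Y : V) : ℝ :=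
  LinearMap.trace ℝ V ((R.flip X).flip Y)

/-- The action of an endomorphism `A` on a `(0,2)`-tensor `T` as a derivation of the tensor
algebra: `(A · T)(X, Y) = -T(AX, Y) - T(X, AY)`. -/
def derivationAction (A : V →ₗ[ℝ] V) (T : V → V → ℝ) (X Y : V) : ℝ :=
  -T (A X) Y - T X (A Y)

/-- `J` is the pseudo-Jacobi operator of `R` with respect to `x`:
`b̃(J y, w) = R(y, x, x, w)`, where `b̃ = b + η ⊗ η` is the form associated with the degenerate
form `b`. -/
def IsPseudoJacobi (b : LinearMap.BilinForm ℝ V) (η : V → ℝ) (R : V →ₗ[ℝ] V →ₗ[ℝ] V →ₗ[ℝ] V)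
    (x : V) (J : V →ₗ[ℝ] V) : Prop :=
  ∀ y w, b (J y) w + η (J y) * η w = b (R y x x) w

/-- The pseudo-sphere `{x | b(x, x) = ε}`; here `ε = 1` (unit spacelike vectors) or `ε = -1`
(unit timelike vectors). -/
def pseudoSphere (b : LinearMap.BilinForm ℝ V) (ε : ℝ) : Set V := {x | b x x = ε}

end PointwiseAlgebra

instance finiteDimensionalTangentSpace {E : Type*} [NormedAddCommGroup E] [NormedSpace ℝ E]
    [FiniteDimensional ℝ E] {M : Type*} [TopologicalSpace M] [ChartedSpace E M] (u : M) :
    FiniteDimensional ℝ (TangentSpace 𝓘(ℝ, E) u) :=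
  inferInstanceAs (FiniteDimensional ℝ E)

section Transversal

variable {V : Type*} [AddCommGroup V] [Module ℝ V] [TopologicalSpace V]
  {W : Type*} [AddCommGroup W] [Module ℝ W] [TopologicalSpace W] [IsTopologicalAddGroup W]
  [ContinuousConstSMul ℝ W]

/-- Let `A : V → W` be the differential of a lightlike hypersurface at a point, `G` the ambient
metric and `S ⊆ V` the screen. `(ξ, N)` is a normalizing pair: `ξ` spans the radical, and `N` is
the null vector orthogonal to the screen with `G(ξ, N) = 1`. -/
structure IsNormalizingPair (G : W →L[ℝ] W →L[ℝ] ℝ) (A : V →L[ℝ] W) (S : Submodule ℝ V)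
    (ξ : V) (N : W) : Prop where
  radical : ∀ v, G (A ξ) (A v) = 0
  pairing : G (A ξ) N = 1
  null : G N N = 0
  orthogonal : ∀ s ∈ S, G (A s) N = 0

/-- The lightlike transversal space `ltr(TM)` at a point, determined by the screen `S`. -/
def lightlikeTransversal (G : W →L[ℝ] W →L[ℝ] ℝ) (A : V →L[ℝ] W) (S : Submodule ℝ V) :
    Submodule ℝ W :=
  Submodule.span ℝ {N | ∃ ξ, IsNormalizingPair G A S ξ N}

open Classical in
/-- The tangential component with respect to the splitting `W = A(V) ⊕ ltr`: the unique linear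
map `T : W → V` with `T ∘ A = id` that vanishes on `ltr`. -/
def tangentialProjection (G : W →L[ℝ] W →L[ℝ] ℝ) (A : V →L[ℝ] W) (S : Submodule ℝ V) :
    W →L[ℝ] V :=
  if h : ∃ T : W →L[ℝ] V, (∀ v, T (A v) = v) ∧ ∀ N ∈ lightlikeTransversal G A S, T N = 0
  then h.choose else 0

end Transversal

/-! ## Linear connections in a coordinate domain -/

section Coordinates

variable {E : Type*} [NormedAddCommGroup E] [NormedSpace ℝ E]
  {E' : Type*} [NormedAddCommGroup E'] [NormedSpace ℝ E']

/-- The curvature `R(a, b)c` at `x` of the connection `∇_a Y = DY(a) + Γ(a, Y)` with Christoffel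
symbols `Γ`, for `R(X,Y) = ∇_X ∇_Y - ∇_Y ∇_X - ∇_[X,Y]`, i.e.
`R(a,b)c = (D_a Γ)(b,c) - (D_b Γ)(a,c) + Γ(a, Γ(b,c)) - Γ(b, Γ(a,c))`. -/
def coordCurvature (Γ : E → E →L[ℝ] E →L[ℝ] E) (x : E) : E →ₗ[ℝ] E →ₗ[ℝ] E →ₗ[ℝ] E :=
  LinearMap.mk₂ ℝ
    (fun a b ↦ ((fderiv ℝ Γ x a b - fderiv ℝ Γ x b a + (Γ x a) ∘L (Γ x b) -
      (Γ x b) ∘L (Γ x a) : E →L[ℝ] E) : E →ₗ[ℝ] E))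
    (fun a a' b ↦ by ext c; simp; abel)
    (fun r a b ↦ by ext c; simp [smul_sub, smul_add])
    (fun a b b' ↦ by ext c; simp; abel)
    (fun r a b ↦ by ext c; simp [smul_sub, smul_add])

theorem coordCurvature_apply (Γ : E → E →L[ℝ] E →L[ℝ] E) (x a b c : E) :
    coordCurvature Γ x a b c =
      fderiv ℝ Γ x a b c - fderiv ℝ Γ x b a c + Γ x a (Γ x b c) - Γ x b (Γ x a c) :=
  rfl

/-- The Christoffel symbols of the first kind of a metric `G`:
`½ (∂_a G(b, c) + ∂_b G(a, c) - ∂_c G(a, b))`, as a linear form in `c`. -/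
def christoffelFirst (G : E → E →L[ℝ] E →L[ℝ] ℝ) (x : E) : E →L[ℝ] E →L[ℝ] E →L[ℝ] ℝ :=
  let D : E →L[ℝ] E →L[ℝ] E →L[ℝ] ℝ := fderiv ℝ G x
  let flip : (E →L[ℝ] E →L[ℝ] ℝ) →L[ℝ] (E →L[ℝ] E →L[ℝ] ℝ) :=
    (ContinuousLinearMap.flipₗᵢ ℝ E E ℝ).toContinuousLinearEquiv.toContinuousLinearMap
  (1 / 2 : ℝ) • (D + D.flip - flip ∘L D.flip)

theorem christoffelFirst_apply (G : E → E →L[ℝ] E →L[ℝ] ℝ) (x a b c : E) :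
    christoffelFirst G x a b c =
      (1 / 2) * (fderiv ℝ G x a b c + fderiv ℝ G x b a c - fderiv ℝ G x c a b) := by
  simp [christoffelFirst]

/-- The Christoffel symbols `Γ(a, b)` of the Levi-Civita connection of a metric `G`: the index of
the symbols of the first kind is raised with the inverse of `G`. -/
def christoffel (G : E → E →L[ℝ] E →L[ℝ] ℝ) (x : E) : E →L[ℝ] E →L[ℝ] E :=
  (ContinuousLinearMap.compL ℝ E (E →L[ℝ] ℝ) E (G x).inverse) ∘L (christoffelFirst G x)

theorem christoffel_apply (G : E → E →L[ℝ] E →L[ℝ] ℝ) (x a b : E) :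
    christoffel G x a b = (G x).inverse (christoffelFirst G x a b) := by
  simp [christoffel]

/-- The ambient derivative `∇̄_a (df(b)) = D²f(a, b) + Γ̄(df(a), df(b))` along a map `f` of
coordinate domains, for a constant field `b`; here `Γ̄` belongs to the Levi-Civita connection of
the ambient metric `G`. -/
def derivAlong (G : E' → E' →L[ℝ] E' →L[ℝ] ℝ) (f : E → E') (x : E) : E →L[ℝ] E →L[ℝ] E' :=
  fderiv ℝ (fderiv ℝ f) x + (christoffel G (f x)).bilinearComp (fderiv ℝ f x) (fderiv ℝ f x)

/-- The Christoffel symbols of the connection induced on a lightlike hypersurface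
`f` by a screen `S`: `Γ(a, b)` is the tangential component of `∇̄_a (df(b))` with respect to
`f^*TM̄ = TM ⊕ ltr(TM)` (Gauss formula). -/
def inducedChristoffel (G : E' → E' →L[ℝ] E' →L[ℝ] ℝ) (f : E → E') (S : E → Submodule ℝ E)
    (x : E) : E →L[ℝ] E →L[ℝ] E :=
  (ContinuousLinearMap.compL ℝ E E' E
    (tangentialProjection (G (f x)) (fderiv ℝ f x) (S x))) ∘L (derivAlong G f x)

theorem inducedChristoffel_apply (G : E' → E' →L[ℝ] E' →L[ℝ] ℝ) (f : E → E')
    (S : E → Submodule ℝ E) (x a b : E) :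
    inducedChristoffel G f S x a b =
      tangentialProjection (G (f x)) (fderiv ℝ f x) (S x)
        (fderiv ℝ (fderiv ℝ f) x a b +
          christoffel G (f x) (fderiv ℝ f x a) (fderiv ℝ f x b)) := by
  simp [inducedChristoffel, derivAlong]

end Coordinates

/-! ## Semi-Riemannian manifolds -/

section Ambient

variable (E' : Type*) [NormedAddCommGroup E'] [NormedSpace ℝ E']
  (M' : Type*) [TopologicalSpace M'] [ChartedSpace E' M'] [IsManifold 𝓘(ℝ, E') ∞ M']

/-- A semi-Riemannian metric: a smooth symmetric nondegenerate `(0,2)`-tensor field of constant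
index. -/
structure SemiRiemannianMetric where
  /-- the scalar product on each tangent space -/
  val : ∀ p : M', TangentSpace 𝓘(ℝ, E') p →L[ℝ] TangentSpace 𝓘(ℝ, E') p →L[ℝ] ℝ
  symm : ∀ p v w, val p v w = val p w v
  nondegenerate : ∀ p v, (∀ w, val p v w = 0) → v = 0
  index_const : ∃ ν : ℕ, ∀ p,
    sigNeg (LinearMap.BilinMap.toQuadraticMap (val p).toLinearMap₁₂) = ν
  contMDiff : ContMDiff 𝓘(ℝ, E') (𝓘(ℝ, E').prod 𝓘(ℝ, E' →L[ℝ] E' →L[ℝ] ℝ)) ∞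
    (fun p ↦ Bundle.TotalSpace.mk' (E' →L[ℝ] E' →L[ℝ] ℝ) p (val p))

end Ambient

section Ambient

variable {E' : Type*} [NormedAddCommGroup E'] [NormedSpace ℝ E']
  {M' : Type*} [TopologicalSpace M'] [ChartedSpace E' M'] [IsManifold 𝓘(ℝ, E') ∞ M']
  (g : SemiRiemannianMetric E' M')

namespace SemiRiemannianMetric

/-- The components of the metric in the preferred chart `ψ` around `p`:
`(v, w) ↦ g(dψ⁻¹ v, dψ⁻¹ w)` at the point with coordinates `y`. -/
def inChart (p : M') (y : E') : E' →L[ℝ] E' →L[ℝ] ℝ :=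
  let dψ : E' →L[ℝ] E' := mfderiv 𝓘(ℝ, E') 𝓘(ℝ, E') (extChartAt 𝓘(ℝ, E') p).symm y
  let G : E' →L[ℝ] E' →L[ℝ] ℝ := g.val ((extChartAt 𝓘(ℝ, E') p).symm y)
  G.bilinearComp dψ dψ

theorem inChart_apply (p : M') (y v w : E') :
    g.inChart p y v w = g.val ((extChartAt 𝓘(ℝ, E') p).symm y)
      (mfderiv 𝓘(ℝ, E') 𝓘(ℝ, E') (extChartAt 𝓘(ℝ, E') p).symm y v)
      (mfderiv 𝓘(ℝ, E') 𝓘(ℝ, E') (extChartAt 𝓘(ℝ, E') p).symm y w) :=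
  rfl

/-- The Riemann curvature of the Levi-Civita connection at `p`, computed in the preferred chart
around `p`. (In Mathlib a tangent vector at `p` is given by its coordinates in that chart.) -/
def curvature (p : M') : TangentSpace 𝓘(ℝ, E') p →ₗ[ℝ] TangentSpace 𝓘(ℝ, E') p →ₗ[ℝ]
    TangentSpace 𝓘(ℝ, E') p →ₗ[ℝ] TangentSpace 𝓘(ℝ, E') p :=
  (coordCurvature (christoffel (g.inChart p)) (extChartAt 𝓘(ℝ, E') p p) :
    E' →ₗ[ℝ] E' →ₗ[ℝ] E' →ₗ[ℝ] E')

/-- The discriminant `g(v,v) g(w,w) - g(v,w)²`; it is nonzero iff `v`, `w` span a nondegenerate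
plane. -/
def planeDiscriminant (p : M') (v w : TangentSpace 𝓘(ℝ, E') p) : ℝ :=
  g.val p v v * g.val p w w - g.val p v w ^ 2

/-- The sectional curvature of the (nondegenerate) plane spanned by `v` and `w`. -/
def sectionalCurvature (p : M') (v w : TangentSpace 𝓘(ℝ, E') p) : ℝ :=
  g.val p (g.curvature p v w w) v / g.planeDiscriminant p v w

/-- All nondegenerate tangent planes have sectional curvature `c`. -/
def HasConstantCurvature (c : ℝ) : Prop :=
  ∀ p (v w : TangentSpace 𝓘(ℝ, E') p), g.planeDiscriminant p v w ≠ 0 →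
    g.sectionalCurvature p v w = c

end SemiRiemannianMetric

end Ambient

/-! ## Lightlike hypersurfaces -/

section Hypersurface

variable {E' : Type*} [NormedAddCommGroup E'] [NormedSpace ℝ E']
  {M' : Type*} [TopologicalSpace M'] [ChartedSpace E' M'] [IsManifold 𝓘(ℝ, E') ∞ M']
  {E : Type*} [NormedAddCommGroup E] [NormedSpace ℝ E]
  {M : Type*} [TopologicalSpace M] [ChartedSpace E M]
  (g : SemiRiemannianMetric E' M') (F : M → M')

/-- The differential of `F : M → M'` at `u`. -/
abbrev differential (u : M) : TangentSpace 𝓘(ℝ, E) u →L[ℝ] TangentSpace 𝓘(ℝ, E') (F u) :=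
  mfderiv 𝓘(ℝ, E) 𝓘(ℝ, E') F u

/-- The induced (degenerate) metric on `T_uM`. -/
def inducedMetric (u : M) : LinearMap.BilinForm ℝ (TangentSpace 𝓘(ℝ, E) u) :=
  (g.val (F u)).toLinearMap₁₂.compl₁₂ (differential F u).toLinearMap (differential F u).toLinearMap

/-- The radical `Rad T_uM = T_uM ∩ T_uM^⊥`. -/
def radical (u : M) : Submodule ℝ (TangentSpace 𝓘(ℝ, E) u) :=
  LinearMap.ker (inducedMetric g F u)

/-- `F : M → M'` is an (immersed) lightlike hypersurface: a smooth immersion of codimension one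
whose induced metric is degenerate at every point. (The radical is then automatically a smooth
distribution of rank one.) -/
structure IsLightlikeHypersurface : Prop where
  contMDiff : ContMDiff 𝓘(ℝ, E) 𝓘(ℝ, E') ∞ F
  injective_differential : ∀ u, Function.Injective (differential (E := E) (E' := E') F u)
  codim : Module.finrank ℝ E' = Module.finrank ℝ E + 1
  degenerate : ∀ u, radical (E := E) g F u ≠ ⊥

/-- A screen distribution: a smooth distribution on `M` complementary to the radical. Smoothness:
every vector of the distribution extends to a local smooth section. -/
structure ScreenDistribution (E : Type*) [NormedAddCommGroup E] [NormedSpace ℝ E]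
    {M : Type*} [TopologicalSpace M] [ChartedSpace E M] [IsManifold 𝓘(ℝ, E) ∞ M]
    (g : SemiRiemannianMetric E' M') (F : M → M') where
  /-- the screen at each point -/
  space : ∀ u : M, Submodule ℝ (TangentSpace 𝓘(ℝ, E) u)
  isCompl : ∀ u, IsCompl (space u) (radical g F u)
  smooth : ∀ u, ∀ v ∈ space u, ∃ X : ∀ y : M, TangentSpace 𝓘(ℝ, E) y, ∃ U ∈ 𝓝 u,
    ContMDiffOn 𝓘(ℝ, E) 𝓘(ℝ, E).tangent ∞ (fun y ↦ (⟨y, X y⟩ : TangentBundle 𝓘(ℝ, E) M)) U ∧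
      (∀ y ∈ U, X y ∈ space y) ∧ X u = v

variable [IsManifold 𝓘(ℝ, E) ∞ M] {g F} (S : ScreenDistribution E g F)

namespace ScreenDistribution

/-- The screen distribution in the preferred chart around `u`. -/
def inChart (u : M) (x : E) : Submodule ℝ E :=
  let dφ : E →L[ℝ] TangentSpace 𝓘(ℝ, E) ((extChartAt 𝓘(ℝ, E) u).symm x) :=
    mfderiv 𝓘(ℝ, E) 𝓘(ℝ, E) (extChartAt 𝓘(ℝ, E) u).symm x
  (S.space ((extChartAt 𝓘(ℝ, E) u).symm x)).comap dφ.toLinearMap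

/-- The Riemann curvature `R` at `u` of the connection induced on the hypersurface by the screen,
computed in the preferred charts around `u` and `F u`. -/
def curvature (u : M) : TangentSpace 𝓘(ℝ, E) u →ₗ[ℝ] TangentSpace 𝓘(ℝ, E) u →ₗ[ℝ]
    TangentSpace 𝓘(ℝ, E) u →ₗ[ℝ] TangentSpace 𝓘(ℝ, E) u :=
  (coordCurvature (inducedChristoffel (g.inChart (F u))
    (writtenInExtChartAt 𝓘(ℝ, E) 𝓘(ℝ, E') u F) (S.inChart u)) (extChartAt 𝓘(ℝ, E) u u) :
      E →ₗ[ℝ] E →ₗ[ℝ] E →ₗ[ℝ] E)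

/-- The screen is admissible: its induced curvature is an algebraic curvature tensor. -/
def IsAdmissible : Prop :=
  ∀ u, IsAlgebraicCurvature (inducedMetric g F u) (S.curvature u)

/-- `M` with the screen is Ricci semi-symmetric: `R(V₁, V₂) · Ric = 0`. -/
def IsRicciSemiSymmetric : Prop :=
  ∀ (u : M) (V₁ V₂ X Y : TangentSpace 𝓘(ℝ, E) u),
    derivationAction (S.curvature u V₁ V₂) (ricci (S.curvature u)) X Y = 0

end ScreenDistribution

variable (g F)

/-- `M` is spacelike (`ε = 1`) or timelike (`ε = -1`) Osserman at `u`: for each admissible screen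
(and each normalizing pair `{ξ, N}` at `u`, with `η = ḡ(·, N)`), the characteristic polynomial of
the pseudo-Jacobi operator `J_R(x)` is independent of `x` in the pseudo-sphere `g(x, x) = ε`. -/
def OssermanOnSphere [FiniteDimensional ℝ E] (ε : ℝ) (u : M) : Prop :=
  ∀ S : ScreenDistribution E g F, S.IsAdmissible →
    ∀ (ξ : TangentSpace 𝓘(ℝ, E) u) (N : TangentSpace 𝓘(ℝ, E') (F u)),
      IsNormalizingPair (g.val (F u)) (differential F u) (S.space u) ξ N →
      ∃ P : Polynomial ℝ, ∀ x ∈ pseudoSphere (inducedMetric g F u) ε,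
        ∀ J : TangentSpace 𝓘(ℝ, E) u →ₗ[ℝ] TangentSpace 𝓘(ℝ, E) u,
          IsPseudoJacobi (inducedMetric g F u) (fun v ↦ g.val (F u) (differential F u v) N)
            (S.curvature u) x J →
          J.charpoly = P

/-- `M` is Osserman at `u`: spacelike Osserman or timelike Osserman there. The two conditions are
equivalent when both pseudo-spheres are nonempty; a condition on an empty pseudo-sphere counts
only if the other one is empty too, which happens just for one-dimensional `M`. -/
def IsOssermanAt [FiniteDimensional ℝ E] (u : M) : Prop :=
  ((pseudoSphere (inducedMetric (E := E) g F u) 1).Nonempty ∧ OssermanOnSphere (E := E) g F 1 u) ∨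
  ((pseudoSphere (inducedMetric (E := E) g F u) (-1)).Nonempty ∧
    OssermanOnSphere (E := E) g F (-1) u) ∨
  (pseudoSphere (inducedMetric (E := E) g F u) 1 = ∅ ∧
    pseudoSphere (inducedMetric (E := E) g F u) (-1) = ∅)

/-- `M` is pointwise Osserman. -/
def IsPointwiseOsserman (E : Type*) [NormedAddCommGroup E] [NormedSpace ℝ E]
    [FiniteDimensional ℝ E] {M : Type*} [TopologicalSpace M] [ChartedSpace E M]
    [IsManifold 𝓘(ℝ, E) ∞ M] (g : SemiRiemannianMetric E' M') (F : M → M') : Prop :=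
  ∀ u : M, IsOssermanAt (E := E) g F u

end Hypersurface

end LightlikeOsserman
end

set_option maxSynthPendingDepth 3

noncomputable section

namespace LightlikeOsserman

/-! ### Pointwise algebra: from the Osserman condition to a Ricci tensor proportional to the metric.
-/

section PointwiseRicci

variable {V : Type*} [AddCommGroup V] [Module ℝ V]

/-! The point is that `Ric = κ g` at each point. Admissibility makes every `R(V₁, V₂)` skew for `g`,
so `R(V₁, V₂) · Ric = κ R(V₁, V₂) · g = 0` (`derivationAction_eq_zero_of_ricci_eq`).

To get `Ric = κ g`, fix a normalizing pair `ξ, N` and remove from `y ↦ R(y, X)Y` its `ξ`-component.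
What remains is, for `X = Y = x`, the pseudo-Jacobi operator `J_R(x)`; what was removed has rank one
and trace `η(R(ξ, X)Y)`. Hence `Ric(x, x) = tr J_R(x) + η(R(ξ, x)x)`. The trace is a coefficient of
the characteristic polynomial, so by the Osserman condition it is constant on the pseudo-sphere.

The second term is where constant curvature enters (`transversal_curvature`). In the Gauss formula
`∇̄_b df(c) = df(Γ(b, c)) + B(b, c) N`, a further derivative adds only multiples of `N` and of `∇̄N`
to the induced terms. Both are orthogonal to `N` because `N` stays null, so `R` and `R̄` have the
same pairing with `N` (`gauss_equation`). For constant curvature `c` this gives `η(R(ξ, X)Y) = c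
g(X, Y)`.

Thus `Ric(x, x)` is constant on a nonempty pseudo-sphere. Ric is symmetric, and scaling together
with a polynomial argument forces it to be a multiple of `g`
(`eq_smul_of_constant_on_pseudoSphere`). If there are no unit vectors at all, then `g = 0` and `Ric
= 0` directly.

The remaining work is analytic: smooth local normalizing pairs, the symmetries of the Levi-Civita
curvature, and the passage between tangent spaces and charts. -/

theorem IsAlgebraicCurvature.antisymm_right {b : LinearMap.BilinForm ℝ V}
    {R : V →ₗ[ℝ] V →ₗ[ℝ] V →ₗ[ℝ] V} (h : IsAlgebraicCurvature b R) (x y z w : V) :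
    b (R x y z) w = -b (R x y w) z := by
  rw [h.pair_symm, h.antisymm, h.pair_symm w z]

/-- A quadratic polynomial vanishing for all large arguments has constant term zero. -/
theorem eq_zero_of_quadratic_eventually_zero {p q r T : ℝ}
    (h : ∀ t > T, p + q * t + r * t ^ 2 = 0) : p = 0 := by
  have h1 := h (|T| + 1) (by linarith [le_abs_self T])
  have h2 := h (|T| + 2) (by linarith [le_abs_self T])
  have h3 := h (|T| + 3) (by linarith [le_abs_self T])
  have hr : r = 0 := by linear_combination (h1 - 2 * h2 + h3) / 2
  have hq : q = 0 := by subst hr; linear_combination h2 - h1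
  subst hr hq
  linarith

/-- A symmetric form `Q` that is constant on a nonempty pseudo-sphere of `b` is proportional
to `b`. -/
theorem eq_smul_of_constant_on_pseudoSphere {b Q : LinearMap.BilinForm ℝ V}
    (hb : ∀ x y, b x y = b y x) (hQ : ∀ x y, Q x y = Q y x) {ε κ : ℝ} (hε : ε ^ 2 = 1)
    (hne : (pseudoSphere b ε).Nonempty) (h : ∀ x ∈ pseudoSphere b ε, Q x x = κ) (x y : V) :
    Q x y = ε * κ * b x y := by
  -- Homogeneity extends the relation from the pseudo-sphere to the open cone over it.
  have hscale : ∀ x, 0 < ε * b x x → Q x x = ε * κ * b x x := by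
    intro x hx
    have hs : Real.sqrt (ε * b x x) ^ 2 = ε * b x x := Real.sq_sqrt hx.le
    have hs0 : Real.sqrt (ε * b x x) ≠ 0 := (Real.sqrt_pos.2 hx).ne'
    set s := Real.sqrt (ε * b x x)
    have hmem : s⁻¹ • x ∈ pseudoSphere b ε := by
      simp only [pseudoSphere, Set.mem_ofPred_eq, map_smul, LinearMap.smul_apply, smul_eq_mul]
      field_simp
      linear_combination ε * hs.symm - b x x * hε
    have := h _ hmem
    simp only [map_smul, LinearMap.smul_apply, smul_eq_mul] at this
    field_simp at this
    rw [this, hs]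
    ring
  obtain ⟨x₀, hx₀⟩ := hne
  replace hx₀ : b x₀ x₀ = ε := hx₀
  -- For large `t` the vector `x + t x₀` lies in the cone, since `ε b(x₀, x₀) = 1`. The quadratic
  -- polynomial `(Q - εκb)(x + t x₀)` therefore vanishes for large `t`, and its constant term is the
  -- claim.
  have hdiag : ∀ x, Q x x - ε * κ * b x x = 0 := by
    intro x
    refine eq_zero_of_quadratic_eventually_zero
      (q := 2 * (Q x x₀ - ε * κ * b x x₀)) (r := Q x₀ x₀ - ε * κ * b x₀ x₀)
      -- Beyond this bound `t² - 2t|b(x, x₀)| - |b(x, x)|` is positive.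
      (T := 2 * |b x x₀| + |b x x| + 1) fun t ht ↦ ?_
    have hpos : 0 < ε * b (x + t • x₀) (x + t • x₀) := by
      have : ε * b (x + t • x₀) (x + t • x₀)
          = ε * b x x + t * (2 * (ε * b x x₀)) + t ^ 2 := by
        simp only [map_add, map_smul, LinearMap.add_apply, LinearMap.smul_apply, smul_eq_mul,
          hb x₀ x, hx₀]
        linear_combination t ^ 2 * hε
      have hε' : |ε| = 1 := by
        rw [← abs_one, ← sq_eq_sq_iff_abs_eq_abs, hε, one_pow]
      have h1 : -|b x x| ≤ ε * b x x := by
        have := neg_abs_le (ε * b x x); rwa [abs_mul, hε', one_mul] at this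
      have h2 : -|b x x₀| ≤ ε * b x x₀ := by
        have := neg_abs_le (ε * b x x₀); rwa [abs_mul, hε', one_mul] at this
      have := abs_nonneg (b x x)
      have := abs_nonneg (b x x₀)
      rw [‹ε * b (x + t • x₀) (x + t • x₀) = _›]
      nlinarith
    have := hscale _ hpos
    simp only [map_add, map_smul, LinearMap.add_apply, LinearMap.smul_apply, smul_eq_mul,
      hb x₀ x, hQ x₀ x] at this
    linear_combination this
  have h1 := hdiag (x + y)
  have h2 := hdiag x
  have h3 := hdiag y
  simp only [map_add, LinearMap.add_apply, hb y x, hQ y x] at h1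
  linear_combination (h1 - h2 - h3) / 2

/-- Operators that are adjoint with respect to a nondegenerate form have the same trace. -/
theorem trace_eq_of_adjoint [FiniteDimensional ℝ V] {β : LinearMap.BilinForm ℝ V}
    (hβ : ∀ v, (∀ w, β v w = 0) → v = 0) {J K : V →ₗ[ℝ] V}
    (h : ∀ y w, β (J y) w = β y (K w)) :
    LinearMap.trace ℝ V J = LinearMap.trace ℝ V K := by
  have hinj : Function.Injective β := by
    rw [injective_iff_map_eq_zero]
    intro v hv
    exact hβ v fun w ↦ by rw [hv]; rfl
  let e : V ≃ₗ[ℝ] Module.Dual ℝ V :=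
    LinearEquiv.ofInjectiveOfFinrankEq β hinj (Subspace.dual_finrank_eq).symm
  have he : ∀ v, e v = β v := fun v ↦ rfl
  -- The form identifies `V` with its dual and carries `J` to the transpose of `K`.
  have : e.conj J = Module.Dual.transpose (R := ℝ) K := by
    ext φ w
    obtain ⟨v, rfl⟩ := e.surjective φ
    rw [LinearEquiv.conj_apply_apply, LinearEquiv.symm_apply_apply, he, he, h,
      Module.Dual.transpose_apply, LinearMap.comp_apply]
  rw [← LinearMap.trace_conj' J e, this, LinearMap.trace_transpose']

theorem trace_eq_neg_nextCoeff_charpoly [FiniteDimensional ℝ V] (J : V →ₗ[ℝ] V) :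
    LinearMap.trace ℝ V J = -J.charpoly.nextCoeff := by
  rw [LinearMap.charpoly_def, ← Matrix.trace_eq_neg_charpoly_nextCoeff,
    LinearMap.trace_eq_matrix_trace ℝ (Module.Free.chooseBasis ℝ V)]

/-- The screen part of `y ↦ R(y, X)Y`. -/
def screenJacobi (η : V →ₗ[ℝ] ℝ) (ξ : V) (R : V →ₗ[ℝ] V →ₗ[ℝ] V →ₗ[ℝ] V) (X Y : V) :
    V →ₗ[ℝ] V :=
  (R.flip X).flip Y - (η ∘ₗ (R.flip X).flip Y).smulRight ξ

theorem screenJacobi_apply (η : V →ₗ[ℝ] ℝ) (ξ : V) (R : V →ₗ[ℝ] V →ₗ[ℝ] V →ₗ[ℝ] V)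
    (X Y y : V) : screenJacobi η ξ R X Y y = R y X Y - η (R y X Y) • ξ := rfl

variable {b : LinearMap.BilinForm ℝ V} {R : V →ₗ[ℝ] V →ₗ[ℝ] V →ₗ[ℝ] V}
  {η : V →ₗ[ℝ] ℝ} {ξ : V}

/-- Removing a multiple of `ξ` is invisible to `b`, as `ξ` is radical. Since `η ξ = 1`, it also
makes the `η`-component vanish, so the `η ⊗ η` term contributes nothing. -/
theorem screenJacobi_form (hξ : ∀ v, b ξ v = 0) (hη : η ξ = 1) (X Y y w : V) :
    b (screenJacobi η ξ R X Y y) w + η (screenJacobi η ξ R X Y y) * η w = b (R y X Y) w := by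
  simp [screenJacobi_apply, hξ, hη]

theorem isPseudoJacobi_screenJacobi (hξ : ∀ v, b ξ v = 0) (hη : η ξ = 1) (x : V) :
    IsPseudoJacobi b η R x (screenJacobi η ξ R x x) :=
  fun y w ↦ screenJacobi_form hξ hη x x y w

/-- The removed part `y ↦ η(R(y, X)Y) ξ` has rank one, so its trace is the value of its functional
at `ξ`. -/
theorem ricci_eq_trace_screenJacobi [FiniteDimensional ℝ V] (X Y : V) :
    ricci R X Y = LinearMap.trace ℝ V (screenJacobi η ξ R X Y) + η (R ξ X Y) := by
  simp [ricci, screenJacobi, LinearMap.trace_smulRight]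

/-- The Ricci tensor as a bilinear form. -/
def ricciForm (R : V →ₗ[ℝ] V →ₗ[ℝ] V →ₗ[ℝ] V) : LinearMap.BilinForm ℝ V :=
  LinearMap.mk₂ ℝ (ricci R)
    (fun X X' Y ↦ by rw [ricci, ricci, ricci, ← map_add]; congr 1; ext; simp)
    (fun r X Y ↦ by rw [ricci, ricci, ← map_smul]; congr 1; ext; simp)
    (fun X Y Y' ↦ by rw [ricci, ricci, ricci, ← map_add]; congr 1; ext; simp)
    (fun r X Y ↦ by rw [ricci, ricci, ← map_smul]; congr 1; ext; simp)

theorem ricciForm_apply (X Y : V) : ricciForm R X Y = ricci R X Y := rfl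

/-- The two operators are adjoint for `b + η ⊗ η`, by the pair symmetry of `R`. That form is
nondegenerate: testing a null vector `v` against `ξ` gives `η v = 0`, so `v` is radical and equals
`η v • ξ = 0`. -/
theorem trace_screenJacobi_comm [FiniteDimensional ℝ V] (hR : IsAlgebraicCurvature b R)
    (hb : ∀ x y, b x y = b y x) (hξ : ∀ v, b ξ v = 0) (hη : η ξ = 1)
    (hrad : ∀ v, (∀ w, b v w = 0) → v = η v • ξ) (X Y : V) :
    LinearMap.trace ℝ V (screenJacobi η ξ R X Y) =
      LinearMap.trace ℝ V (screenJacobi η ξ R Y X) := by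
  have hβ : ∀ v w, (b + (η.smulRight η : V →ₗ[ℝ] V →ₗ[ℝ] ℝ)) v w = b v w + η v * η w := by
    intro v w; simp
  refine trace_eq_of_adjoint (β := b + (η.smulRight η : V →ₗ[ℝ] V →ₗ[ℝ] ℝ)) ?_ ?_
  · intro v hv
    simp only [hβ] at hv
    have h0 : η v = 0 := by
      have := hv ξ
      rwa [hb, hξ, hη, zero_add, mul_one] at this
    rw [hrad v fun w ↦ by simpa [h0] using hv w, h0, zero_smul]
  · intro y w
    rw [hβ, screenJacobi_form hξ hη, hβ, hb y, mul_comm, screenJacobi_form hξ hη,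
      hR.pair_symm w, hR.antisymm X, hR.antisymm_right y X w, neg_neg, hR.antisymm_right]

/-- A curvature operator annihilates any Ricci tensor proportional to the metric. -/
theorem derivationAction_eq_zero_of_ricci_eq (hR : IsAlgebraicCurvature b R)
    (hb : ∀ x y, b x y = b y x) {κ : ℝ} (h : ∀ X Y, ricci R X Y = κ * b X Y) (V₁ V₂ X Y : V) :
    derivationAction (R V₁ V₂) (ricci R) X Y = 0 := by
  rw [derivationAction, h, h, hb X, hR.antisymm_right V₁ V₂ X Y]
  ring

/-- If the characteristic polynomials of the Jacobi operators of an algebraic curvature tensor are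
constant on a pseudo-sphere, and `η(R(ξ, X)Y) = c b(X, Y)`, then `Ric` is proportional to `b`. -/
theorem exists_ricci_eq_of_charpoly_constant [FiniteDimensional ℝ V]
    (hR : IsAlgebraicCurvature b R)
    (hb : ∀ x y, b x y = b y x) (hξ : ∀ v, b ξ v = 0) (hη : η ξ = 1)
    (hrad : ∀ v, (∀ w, b v w = 0) → v = η v • ξ) {c : ℝ}
    (hc : ∀ X Y, η (R ξ X Y) = c * b X Y) {ε : ℝ} (hε : ε ^ 2 = 1)
    (hne : (pseudoSphere b ε).Nonempty)
    (hO : ∃ P : Polynomial ℝ, ∀ x ∈ pseudoSphere b ε, ∀ J : V →ₗ[ℝ] V,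
        IsPseudoJacobi b η R x J → J.charpoly = P) :
    ∃ κ : ℝ, ∀ X Y, ricci R X Y = κ * b X Y := by
  obtain ⟨P, hP⟩ := hO
  have hsymm : ∀ X Y, ricciForm R X Y = ricciForm R Y X := by
    intro X Y
    rw [ricciForm_apply, ricciForm_apply, ricci_eq_trace_screenJacobi (η := η) (ξ := ξ) X Y,
      ricci_eq_trace_screenJacobi (η := η) (ξ := ξ) Y X,
      trace_screenJacobi_comm hR hb hξ hη hrad, hc, hc, hb X]
  -- The bracket is the value of `Ric(x, x)` on the pseudo-sphere: the trace `-P.nextCoeff` plus `c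
  -- b(x, x) = cε`.
  refine ⟨ε * (-P.nextCoeff + c * ε), fun X Y ↦ ?_⟩
  refine eq_smul_of_constant_on_pseudoSphere hb hsymm hε hne (fun x hx ↦ ?_) X Y
  rw [ricciForm_apply, ricci_eq_trace_screenJacobi (η := η) (ξ := ξ), hc,
    trace_eq_neg_nextCoeff_charpoly,
    hP x hx _ (isPseudoJacobi_screenJacobi hξ hη x), show b x x = ε from hx]

/-- If the form `b` vanishes, so does the Ricci tensor. -/
theorem ricci_eq_zero_of_form_eq_zero [FiniteDimensional ℝ V] (hb : ∀ x y, b x y = 0)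
    (hrad : ∀ v, (∀ w, b v w = 0) → v = η v • ξ) {c : ℝ}
    (hc : ∀ X Y, η (R ξ X Y) = c * b X Y) (X Y : V) : ricci R X Y = 0 := by
  rw [ricci_eq_trace_screenJacobi (η := η) (ξ := ξ), hc, hb, mul_zero, add_zero]
  -- When `b = 0` every vector is radical, so `R(y, X)Y` coincides with its `ξ`-component.
  have : screenJacobi η ξ R X Y = 0 := by
    ext y
    rw [screenJacobi_apply, ← hrad _ fun w ↦ hb _ _, sub_self, LinearMap.zero_apply]
  rw [this, map_zero]

/-- A symmetric form without vectors of square `±1` vanishes. -/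
theorem form_eq_zero_of_pseudoSphere_empty (hb : ∀ x y, b x y = b y x)
    (h1 : pseudoSphere b 1 = ∅) (h2 : pseudoSphere b (-1) = ∅) (x y : V) : b x y = 0 := by
  have hdiag : ∀ x, b x x = 0 := by
    intro x
    by_contra hx
    set s := Real.sqrt |b x x|
    have hs : s ^ 2 = |b x x| := Real.sq_sqrt (abs_nonneg _)
    have hs0 : s ≠ 0 := (Real.sqrt_pos.2 (abs_pos.2 hx)).ne'
    have hsc : b (s⁻¹ • x) (s⁻¹ • x) = b x x / |b x x| := by
      simp only [map_smul, LinearMap.smul_apply, smul_eq_mul, ← hs]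
      field_simp
    rcases lt_or_gt_of_ne hx with h | h
    · rw [abs_of_neg h, div_neg, div_self hx] at hsc
      exact (Set.eq_empty_iff_forall_notMem.1 h2 _) hsc
    · rw [abs_of_pos h, div_self hx] at hsc
      exact (Set.eq_empty_iff_forall_notMem.1 h1 _) hsc
  have := hdiag (x + y)
  simp only [map_add, LinearMap.add_apply, hdiag, hb y x] at this
  linarith

end PointwiseRicci

/-! ### The curvature tensor of constant sectional curvature in indefinite signature. -/

section ConstantCurvature

/-- The first Bianchi identity and the two antisymmetries imply the pair symmetry. -/
theorem pair_symm_of_bianchi {V : Type*} {D : V → V → V → V → ℝ}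
    (h12 : ∀ x y z w, D x y z w = -D y x z w) (h34 : ∀ x y z w, D x y z w = -D x y w z)
    (hB : ∀ x y z w, D x y z w + D y z x w + D z x y w = 0) (x y z w : V) :
    D x y z w = D z w x y := by
  -- The octahedron argument: four Bianchi identities, with the antisymmetries matching their terms.
  linarith [hB x y z w, hB y z w x, hB z w x y, hB w x y z, h12 x z y w, h12 x z w y, h12 w y z x,
    h12 w y x z, h12 w x y z, h12 y z x w, h34 z x y w, h34 x y z w, h34 y z w x, h34 w y z x,
    h34 z w x y, h34 w x y z, h34 x w y z, h34 y w x z]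

/-- An algebraic curvature tensor with vanishing sectional curvatures vanishes. -/
theorem eq_zero_of_sectional_eq_zero {V : Type*} [AddCommGroup V] [Module ℝ V]
    (D : V →ₗ[ℝ] V →ₗ[ℝ] V →ₗ[ℝ] V →ₗ[ℝ] ℝ)
    (h12 : ∀ x y z w, D x y z w = -D y x z w) (h34 : ∀ x y z w, D x y z w = -D x y w z)
    (hB : ∀ x y z w, D x y z w + D y z x w + D z x y w = 0)
    (h0 : ∀ x y, D x y y x = 0) (x y z w : V) : D x y z w = 0 := by
  have hP := pair_symm_of_bianchi (D := fun x y z w ↦ D x y z w) h12 h34 hB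
  have h1 : ∀ x y w, D x y y w = 0 := by
    intro x y w
    have h := h0 (x + w) y
    simp only [map_add, LinearMap.add_apply, h0] at h
    have : D w y y x = D x y y w := by
      rw [hP w y y x, h12 y x, h34 x y, neg_neg]
    linarith
  have h2 : ∀ x y z w, D x y z w = -D x z y w := by
    intro x y z w
    have h := h1 x (y + z) w
    simp only [map_add, LinearMap.add_apply, h1] at h
    linarith
  -- Now `D` is skew in its first three arguments, so the Bianchi sum is `3 D x y z w`.
  have := hB x y z w
  rw [h2 y z x w, h12 y x z w, h12 z x y w, h2 x z y w] at this
  linarith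

variable {V : Type*} [AddCommGroup V] [Module ℝ V]

/-- The tensor `b(R(x,y)z,w) - c (b(y,z) b(x,w) - b(x,z) b(y,w))`. -/
def curvatureDefect (b : LinearMap.BilinForm ℝ V) (R : V →ₗ[ℝ] V →ₗ[ℝ] V →ₗ[ℝ] V) (c : ℝ) :
    V →ₗ[ℝ] V →ₗ[ℝ] V →ₗ[ℝ] V →ₗ[ℝ] ℝ :=
  LinearMap.mk₂ ℝ (fun x y ↦ b ∘ₗ R x y - c • ((b y).smulRight (b x) - (b x).smulRight (b y)))
    (fun x x' y ↦ by ext z w; simp; ring) (fun r x y ↦ by ext z w; simp; ring)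
    (fun x y y' ↦ by ext z w; simp; ring) (fun r x y ↦ by ext z w; simp; ring)

theorem curvatureDefect_apply (b : LinearMap.BilinForm ℝ V)
    (R : V →ₗ[ℝ] V →ₗ[ℝ] V →ₗ[ℝ] V) (c : ℝ) (x y z w : V) :
    curvatureDefect b R c x y z w = b (R x y z) w - c * (b y z * b x w - b x z * b y w) := by
  simp [curvatureDefect]

/-- Along a line `t ↦ (v + t v₀, w + t w₀)` ending at a nondegenerate plane, the planes are
nondegenerate up to finitely many exceptions. -/
theorem finite_degenerate_planes {b : LinearMap.BilinForm ℝ V} {v₀ w₀ : V}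
    (h₀ : b v₀ v₀ * b w₀ w₀ - b v₀ w₀ ^ 2 ≠ 0) (v w : V) :
    {t : ℝ | b (v + t • v₀) (v + t • v₀) * b (w + t • w₀) (w + t • w₀) -
      b (v + t • v₀) (w + t • w₀) ^ 2 = 0}.Finite := by
  open Polynomial in
  let q (x x₀ y y₀ : V) : ℝ[X] :=
    C (b x y) + C (b x y₀ + b x₀ y) * X + C (b x₀ y₀) * X ^ 2
  have hq : ∀ x x₀ y y₀ t, (q x x₀ y y₀).eval t = b (x + t • x₀) (y + t • y₀) := by
    intro x x₀ y y₀ t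
    simp [q]
    ring
  set P := q v v₀ v v₀ * q w w₀ w w₀ - q v v₀ w w₀ ^ 2 with hPdef
  have hP : ∀ t, P.eval t = b (v + t • v₀) (v + t • v₀) * b (w + t • w₀) (w + t • w₀) -
      b (v + t • v₀) (w + t • w₀) ^ 2 := by
    intro t; simp [P, hq]
  have hne : P ≠ 0 := by
    intro h
    apply h₀
    have hv : ∀ t, P.eval t = 0 := by intro t; simp [h]
    have e0 := hv 0
    have e1 := hv 1
    have e2 := hv (-1)
    have e3 := hv 2
    have e4 := hv (-2)
    simp only [hPdef, q, Polynomial.eval_add, Polynomial.eval_sub, Polynomial.eval_mul,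
      Polynomial.eval_pow, Polynomial.eval_C, Polynomial.eval_X] at e0 e1 e2 e3 e4
    -- The discriminant is a polynomial of degree at most 4 in `t`, and its `t⁴` coefficient is the
    -- discriminant of `v₀, w₀`. The fourth central difference at `-2, …, 2` is `4! = 24` times that
    -- coefficient.
    linear_combination (e3 - 4 * e1 + 6 * e0 - 4 * e2 + e4) / 24
  refine (Polynomial.finite_setOfPred_isRoot hne).subset fun t ht ↦ ?_
  exact (hP t).trans ht

/-- A curvature tensor of constant sectional curvature `c`. -/
theorem curvature_eq_of_constant_sectional {b : LinearMap.BilinForm ℝ V}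
    {R : V →ₗ[ℝ] V →ₗ[ℝ] V →ₗ[ℝ] V} (hb : ∀ x y, b x y = b y x)
    (h12 : ∀ x y z w, b (R x y z) w = -b (R y x z) w)
    (h34 : ∀ x y z w, b (R x y z) w = -b (R x y w) z)
    (hB : ∀ x y z w, b (R x y z) w + b (R y z x) w + b (R z x y) w = 0) {c : ℝ}
    (hc : ∀ v w, b v v * b w w - b v w ^ 2 ≠ 0 →
      b (R v w w) v / (b v v * b w w - b v w ^ 2) = c)
    {v₀ w₀ : V} (h₀ : b v₀ v₀ * b w₀ w₀ - b v₀ w₀ ^ 2 ≠ 0) (x y z w : V) :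
    b (R x y z) w = c * (b y z * b x w - b x z * b y w) := by
  rw [← sub_eq_zero, ← curvatureDefect_apply]
  refine eq_zero_of_sectional_eq_zero _ ?_ ?_ ?_ ?_ x y z w
  · intro x y z w
    rw [curvatureDefect_apply, curvatureDefect_apply, h12]
    ring
  · intro x y z w
    rw [curvatureDefect_apply, curvatureDefect_apply, h34]
    ring
  · intro x y z w
    rw [curvatureDefect_apply, curvatureDefect_apply, curvatureDefect_apply, hb y x, hb z x, hb z y]
    linear_combination hB x y z w
  · intro v w
    set D := curvatureDefect b R c
    have hD : ∀ v w, b v v * b w w - b v w ^ 2 ≠ 0 → D v w w v = 0 := by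
      intro v w h
      have := hc v w h
      rw [div_eq_iff h] at this
      rw [curvatureDefect_apply, this, hb w v]
      ring
    -- The hypothesis covers only nondegenerate planes. Along this line all but finitely many planes
    -- are nondegenerate, so continuity gives the vanishing at `t = 0` as well.
    have hcont : Continuous fun t : ℝ ↦ D (v + t • v₀) (w + t • w₀) (w + t • w₀) (v + t • v₀) := by
      simp only [map_add, map_smul, LinearMap.add_apply, LinearMap.smul_apply, smul_eq_mul]
      repeat' first
        | exact continuous_const | exact continuous_id | apply Continuous.add
        | apply Continuous.mul
    have := hcont.ext_on ((finite_degenerate_planes h₀ v w).countable.dense_compl ℝ) (g := fun _ ↦ 0)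
      continuous_const fun t ht ↦ hD _ _ ht
    simpa using congrFun this 0

end ConstantCurvature

/-! ### Symmetries of the Levi-Civita curvature in coordinates. -/

section LeviCivita

theorem isInvertible_of_injective {V W : Type*} [NormedAddCommGroup V] [NormedSpace ℝ V]
    [NormedAddCommGroup W] [NormedSpace ℝ W] [FiniteDimensional ℝ V] [FiniteDimensional ℝ W]
    (A : V →L[ℝ] W) (hA : Function.Injective A)
    (hd : Module.finrank ℝ V = Module.finrank ℝ W) : A.IsInvertible := by
  refine ⟨(LinearEquiv.ofInjectiveOfFinrankEq A.toLinearMap hA hd).toContinuousLinearEquiv, ?_⟩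
  ext v
  rfl

theorem finrank_continuousDual (V : Type*) [NormedAddCommGroup V] [NormedSpace ℝ V]
    [FiniteDimensional ℝ V] : Module.finrank ℝ (V →L[ℝ] ℝ) = Module.finrank ℝ V := by
  rw [← (LinearMap.toContinuousLinearMap (𝕜 := ℝ) (E := V) (F' := ℝ)).finrank_eq]
  exact Subspace.dual_finrank_eq

theorem isInvertible_of_nondegenerate {V : Type*} [NormedAddCommGroup V] [NormedSpace ℝ V]
    [FiniteDimensional ℝ V] (B : V →L[ℝ] V →L[ℝ] ℝ) (hB : ∀ v, (∀ w, B v w = 0) → v = 0) :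
    B.IsInvertible := by
  refine isInvertible_of_injective B ?_ (finrank_continuousDual V).symm
  rw [injective_iff_map_eq_zero]
  intro v hv
  exact hB v fun w ↦ by rw [hv]; rfl

variable {E' : Type*} [NormedAddCommGroup E'] [NormedSpace ℝ E']

/-- `G` is a smooth semi-Riemannian metric near the point `p` of a coordinate domain. -/
structure IsMetricNear (G : E' → E' →L[ℝ] E' →L[ℝ] ℝ) (p : E') : Prop where
  smooth : ∀ᶠ y in 𝓝 p, ContDiffAt ℝ ∞ G y
  symm : ∀ᶠ y in 𝓝 p, ∀ v w, G y v w = G y w v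
  nondegenerate : ∀ᶠ y in 𝓝 p, ∀ v, (∀ w, G y v w = 0) → v = 0

namespace IsMetricNear

variable {G : E' → E' →L[ℝ] E' →L[ℝ] ℝ} {p : E'}

theorem contDiffAt (h : IsMetricNear G p) : ContDiffAt ℝ ∞ G p :=
  h.smooth.self_of_nhds

theorem eventually (h : IsMetricNear G p) : ∀ᶠ y in 𝓝 p, IsMetricNear G y := by
  filter_upwards [h.smooth.eventually_nhds, h.symm.eventually_nhds,
    h.nondegenerate.eventually_nhds] with y h1 h2 h3
  exact ⟨h1, h2, h3⟩

theorem differentiableAt (h : IsMetricNear G p) : DifferentiableAt ℝ G p :=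
  h.contDiffAt.differentiableAt (by simp)

theorem fderiv_symm (h : IsMetricNear G p) (a b c : E') :
    fderiv ℝ G p a b c = fderiv ℝ G p a c b := by
  have e : (fun y ↦ G y b c) =ᶠ[𝓝 p] fun y ↦ G y c b := h.symm.mono fun y hy ↦ hy b c
  have hd := h.differentiableAt
  have h1 : ∀ b c, fderiv ℝ (fun y ↦ G y b c) p a = fderiv ℝ G p a b c := by
    intro b c
    rw [fderiv_clm_apply (by fun_prop) (by fun_prop), fderiv_clm_apply hd (by fun_prop)]
    simp
  rw [← h1, ← h1, e.fderiv_eq]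

theorem contDiffAt_christoffelFirst (h : IsMetricNear G p) :
    ContDiffAt ℝ ∞ (christoffelFirst G) p := by
  have hD : ContDiffAt ℝ ∞ (fderiv ℝ G) p := h.contDiffAt.fderiv_right (by simp)
  have hF : ContDiffAt ℝ ∞ (fun y ↦ (fderiv ℝ G y).flip) p :=
    (ContinuousLinearMap.flipₗᵢ ℝ E' E' (E' →L[ℝ] ℝ)).contDiff.contDiffAt.comp p hD
  unfold christoffelFirst
  exact ((hD.add hF).sub (contDiffAt_const.clm_comp hF)).const_smul (1 / 2 : ℝ)

variable [FiniteDimensional ℝ E']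

theorem isInvertible (h : IsMetricNear G p) : (G p).IsInvertible :=
  isInvertible_of_nondegenerate _ h.nondegenerate.self_of_nhds

theorem contDiffAt_christoffel (h : IsMetricNear G p) : ContDiffAt ℝ ∞ (christoffel G) p := by
  have : CompleteSpace E' := FiniteDimensional.complete ℝ E'
  have hI : ContDiffAt ℝ ∞ (fun y ↦ (G y).inverse) p :=
    h.isInvertible.contDiffAt_map_inverse.comp p h.contDiffAt
  unfold christoffel
  exact ((ContinuousLinearMap.compL ℝ E' (E' →L[ℝ] ℝ) E').contDiff.contDiffAt.comp p hI).clm_comp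
    h.contDiffAt_christoffelFirst

theorem apply_christoffel (h : IsMetricNear G p) (a b c : E') :
    G p (christoffel G p a b) c = christoffelFirst G p a b c := by
  rw [christoffel_apply, h.isInvertible.self_apply_inverse]

omit [FiniteDimensional ℝ E'] in
theorem christoffel_symm (h : IsMetricNear G p) (a b : E') :
    christoffel G p a b = christoffel G p b a := by
  rw [christoffel_apply, christoffel_apply]
  congr 1
  ext c
  rw [christoffelFirst_apply, christoffelFirst_apply, h.fderiv_symm c a b]
  ring

/-- The Levi-Civita connection is metric. -/
theorem fderiv_eq_christoffel (h : IsMetricNear G p) (a b c : E') :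
    fderiv ℝ G p a b c = G p (christoffel G p a b) c + G p b (christoffel G p a c) := by
  rw [h.symm.self_of_nhds b, h.apply_christoffel, h.apply_christoffel, christoffelFirst_apply,
    christoffelFirst_apply, h.fderiv_symm a c b, h.fderiv_symm b a c, h.fderiv_symm c a b]
  ring

theorem differentiableAt_christoffel (h : IsMetricNear G p) :
    DifferentiableAt ℝ (christoffel G) p :=
  h.contDiffAt_christoffel.differentiableAt (by simp)

/-- Torsion-freeness: `Γ` is symmetric near `p`, hence so is its derivative, and the terms of the
cyclic sum cancel in pairs. -/
theorem coordCurvature_bianchi (h : IsMetricNear G p) (a b c : E') :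
    coordCurvature (christoffel G) p a b c + coordCurvature (christoffel G) p b c a +
      coordCurvature (christoffel G) p c a b = 0 := by
  have hd := h.differentiableAt_christoffel
  have hΓ : ∀ a b c, fderiv ℝ (christoffel G) p a b c = fderiv ℝ (christoffel G) p a c b := by
    intro a b c
    have h1 : ∀ b c, fderiv ℝ (fun y ↦ christoffel G y b c) p a =
        fderiv ℝ (christoffel G) p a b c := by
      intro b c
      rw [fderiv_clm_apply (by fun_prop) (by fun_prop), fderiv_clm_apply hd (by fun_prop)]
      simp
    have e : (fun y ↦ christoffel G y b c) =ᶠ[𝓝 p] fun y ↦ christoffel G y c b :=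
      h.eventually.mono fun y hy ↦ hy.christoffel_symm b c
    rw [← h1, ← h1, e.fderiv_eq]
  simp only [coordCurvature_apply]
  rw [hΓ a b c, hΓ b a c, hΓ c a b, h.christoffel_symm b c, h.christoffel_symm a c,
    h.christoffel_symm a b]
  abel

/-- Second derivatives of `G(c, c)` commute. By metric compatibility the mixed derivative in
directions `a, b` is `2 G(∂_aΓ(b, c) + Γ(a, Γ(b, c)), c)` plus the symmetric term `2 G(Γ(a, c), Γ(b,
c))`, so antisymmetrizing leaves twice the left side. -/
theorem coordCurvature_self (h : IsMetricNear G p) (a b c : E') :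
    G p (coordCurvature (christoffel G) p a b c) c = 0 := by
  have hdG := h.differentiableAt
  have hdΓ := h.differentiableAt_christoffel
  have hφ : ContDiffAt ℝ ∞ (fun y ↦ G y c c) p :=
    (h.contDiffAt.clm_apply contDiffAt_const).clm_apply contDiffAt_const
  have hφ1 : ∀ b, (fun y ↦ fderiv ℝ (fun y ↦ G y c c) y b) =ᶠ[𝓝 p]
      fun y ↦ 2 * G y (christoffel G y b c) c := by
    intro b
    filter_upwards [h.eventually] with y hy
    have hd := hy.differentiableAt
    rw [fderiv_clm_apply (by fun_prop) (by fun_prop), fderiv_clm_apply hd (by fun_prop)]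
    simp only [fderiv_fun_const, Pi.zero_apply, ContinuousLinearMap.comp_zero, zero_add,
      ContinuousLinearMap.flip_apply]
    rw [hy.fderiv_eq_christoffel, hy.symm.self_of_nhds c]
    ring
  have hφ2 : ∀ a b, fderiv ℝ (fderiv ℝ (fun y ↦ G y c c)) p a b =
      2 * (fderiv ℝ G p a (christoffel G p b c) c +
        G p (fderiv ℝ (christoffel G) p a b c) c) := by
    intro a b
    have h1 : fderiv ℝ (fderiv ℝ (fun y ↦ G y c c)) p a b =
        fderiv ℝ (fun y ↦ fderiv ℝ (fun y ↦ G y c c) y b) p a := by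
      have : DifferentiableAt ℝ (fderiv ℝ (fun y ↦ G y c c)) p :=
        (hφ.fderiv_right (m := ∞) (by simp)).differentiableAt (by simp)
      rw [fderiv_clm_apply this (by fun_prop)]
      simp
    have hΓb : DifferentiableAt ℝ (fun y ↦ christoffel G y b) p := by fun_prop
    have hΓbc : DifferentiableAt ℝ (fun y ↦ christoffel G y b c) p := by fun_prop
    have hG1 : DifferentiableAt ℝ (fun y ↦ G y (christoffel G y b c)) p := by fun_prop
    rw [h1, (hφ1 b).fderiv_eq, fderiv_const_mul (by fun_prop),
      fderiv_clm_apply hG1 (by fun_prop), fderiv_clm_apply hdG hΓbc,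
      fderiv_clm_apply hΓb (by fun_prop), fderiv_clm_apply hdΓ (by fun_prop)]
    simp
    ring
  have hsymm := (hφ.isSymmSndFDerivAt (by simpa using ENat.LEInfty.out)).eq a b
  rw [hφ2, hφ2, h.fderiv_eq_christoffel, h.fderiv_eq_christoffel,
    h.symm.self_of_nhds (christoffel G p b c) (christoffel G p a c)] at hsymm
  rw [coordCurvature_apply]
  simp only [map_sub, map_add, add_apply, sub_apply]
  linarith

theorem coordCurvature_antisymm_right (h : IsMetricNear G p) (a b c d : E') :
    G p (coordCurvature (christoffel G) p a b c) d =
      -G p (coordCurvature (christoffel G) p a b d) c := by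
  have := h.coordCurvature_self a b (c + d)
  simp only [map_add, add_apply, h.coordCurvature_self] at this
  linarith

omit [FiniteDimensional ℝ E'] in
theorem coordCurvature_antisymm (Γ : E' → E' →L[ℝ] E' →L[ℝ] E') (p a b c : E') :
    coordCurvature Γ p a b c = -coordCurvature Γ p b a c := by
  simp only [coordCurvature_apply]
  abel

end IsMetricNear

end LeviCivita

/-! ### Linear algebra of a lightlike hyperplane, its screen and its null transversal. -/

section LightlikeAlgebra

variable {E : Type*} [NormedAddCommGroup E] [NormedSpace ℝ E]
  {E' : Type*} [NormedAddCommGroup E'] [NormedSpace ℝ E']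

/-- The radical of the form induced by `G` along `A`. -/
def inducedRadical (G : E' →L[ℝ] E' →L[ℝ] ℝ) (A : E →L[ℝ] E') : Submodule ℝ E :=
  LinearMap.ker (G.bilinearComp A A : E →L[ℝ] E →L[ℝ] ℝ).toLinearMap

theorem mem_inducedRadical {G : E' →L[ℝ] E' →L[ℝ] ℝ} {A : E →L[ℝ] E'} {v : E} :
    v ∈ inducedRadical G A ↔ ∀ w, G (A v) (A w) = 0 := by
  simp [inducedRadical, ContinuousLinearMap.ext_iff]

/-- `A` is the differential of a lightlike hypersurface at a point, and `S` a screen. -/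
structure IsLightlike (G : E' →L[ℝ] E' →L[ℝ] ℝ) (A : E →L[ℝ] E') (S : Submodule ℝ E) :
    Prop where
  symm : ∀ v w, G v w = G w v
  nondegenerate : ∀ v, (∀ w, G v w = 0) → v = 0
  injective : Function.Injective A
  codim : Module.finrank ℝ E' = Module.finrank ℝ E + 1
  degenerate : inducedRadical G A ≠ ⊥
  isCompl : IsCompl S (inducedRadical G A)

namespace IsLightlike

variable {G : E' →L[ℝ] E' →L[ℝ] ℝ} {A : E →L[ℝ] E'} {S : Submodule ℝ E}

/-- The induced form is nondegenerate on the screen: a screen vector orthogonal to the screen is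
also orthogonal to the complementary radical, hence lies in both. -/
theorem eq_zero_of_orthogonal (h : IsLightlike G A S) {s : E} (hs : s ∈ S)
    (ho : ∀ s' ∈ S, G (A s) (A s') = 0) : s = 0 := by
  refine Submodule.disjoint_def.1 h.isCompl.disjoint s hs (mem_inducedRadical.2 fun w ↦ ?_)
  obtain ⟨t, r, ht, hr, rfl⟩ := Submodule.codisjoint_iff_exists_add_eq.1 h.isCompl.codisjoint w
  rw [map_add, map_add, ho t ht, h.symm, mem_inducedRadical.1 hr, add_zero]

theorem mem_radical_of_orthogonal (h : IsLightlike G A S) {v : E}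
    (ho : ∀ s ∈ S, G (A v) (A s) = 0) : v ∈ inducedRadical G A := by
  refine mem_inducedRadical.2 fun w ↦ ?_
  obtain ⟨t, r, ht, hr, rfl⟩ := Submodule.codisjoint_iff_exists_add_eq.1 h.isCompl.codisjoint w
  rw [map_add, map_add, ho t ht, h.symm, mem_inducedRadical.1 hr, add_zero]

variable [FiniteDimensional ℝ E] [FiniteDimensional ℝ E']

/-- The map `(v, t) ↦ A v + t N`, which realizes the splitting `TM ⊕ ltr(TM)`. -/
def transversalMap (A : E →L[ℝ] E') (N : E') : E × ℝ →L[ℝ] E' :=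
  A.coprod (ContinuousLinearMap.toSpanSingleton ℝ N)

omit [FiniteDimensional ℝ E] [FiniteDimensional ℝ E'] in
theorem transversalMap_apply (A : E →L[ℝ] E') (N : E') (v : E) (t : ℝ) :
    transversalMap A N (v, t) = A v + t • N := by
  simp [transversalMap]

variable {ξ : E} {N : E'}

/-- Pairing with `A ξ` kills tangent vectors and detects the coefficient of `N`, which gives
injectivity; codimension one makes the dimensions agree. -/
theorem isInvertible_transversalMap (h : IsLightlike G A S)
    (hr : ξ ∈ inducedRadical G A) (hN : G (A ξ) N ≠ 0) : (transversalMap A N).IsInvertible := by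
  refine isInvertible_of_injective _ ?_ (by simp [h.codim])
  rw [injective_iff_map_eq_zero]
  rintro ⟨v, t⟩ hvt
  rw [transversalMap_apply] at hvt
  have ht : t = 0 := by
    have := congrArg (G (A ξ)) hvt
    rw [map_add, mem_inducedRadical.1 hr, map_smul, map_zero, zero_add, smul_eq_mul] at this
    exact (mul_eq_zero.1 this).resolve_right hN
  rw [ht, zero_smul, add_zero] at hvt
  rw [ht, (injective_iff_map_eq_zero A).1 h.injective v hvt]
  rfl

theorem exists_decomposition (h : IsLightlike G A S) (hr : ξ ∈ inducedRadical G A)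
    (hN : G (A ξ) N ≠ 0) (w : E') : ∃ (v : E) (t : ℝ), w = A v + t • N := by
  obtain ⟨⟨v, t⟩, rfl⟩ := (h.isInvertible_transversalMap hr hN).surjective w
  exact ⟨v, t, transversalMap_apply A N v t⟩

/-- The difference of the two sides has image orthogonal both to the hyperplane and to `N`, hence to
everything. In particular the radical is a line. -/
theorem eq_smul_of_mem_radical (h : IsLightlike G A S) (hp : IsNormalizingPair G A S ξ N)
    {r : E} (hr : r ∈ inducedRadical G A) : r = G (A r) N • ξ := by
  have hξ : ξ ∈ inducedRadical G A := mem_inducedRadical.2 hp.radical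
  rw [← sub_eq_zero]
  apply (injective_iff_map_eq_zero A).1 h.injective
  apply h.nondegenerate
  intro w
  obtain ⟨v, t, rfl⟩ := h.exists_decomposition hξ (by rw [hp.pairing]; exact one_ne_zero) w
  have := mem_inducedRadical.1 (sub_mem hr (Submodule.smul_mem _ (G (A r) N) hξ)) v
  rw [map_add, this, zero_add]
  simp [hp.pairing]

/-- Write `N' = A v + t N`. Orthogonality to the screen makes `v` radical, the pairing with `ξ'`
forces `t ≠ 0`, and nullity then gives `G(A v, N) = 0`, so `v = 0`. -/
theorem eq_smul_of_mem_transversal (h : IsLightlike G A S) (hp : IsNormalizingPair G A S ξ N)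
    {ξ' : E} {N' : E'} (hp' : IsNormalizingPair G A S ξ' N') : ∃ t : ℝ, N' = t • N := by
  have hξ : ξ ∈ inducedRadical G A := mem_inducedRadical.2 hp.radical
  obtain ⟨v, t, hvt⟩ := h.exists_decomposition hξ (by rw [hp.pairing]; exact one_ne_zero) N'
  have hv : v ∈ inducedRadical G A := by
    refine h.mem_radical_of_orthogonal fun s hs ↦ ?_
    have := hp'.orthogonal s hs
    rwa [hvt, map_add, map_smul, hp.orthogonal s hs, smul_zero, add_zero, h.symm] at this
  have ht : t ≠ 0 := by
    rintro rfl
    have := hp'.pairing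
    rw [hvt, zero_smul, add_zero, hp'.radical] at this
    exact zero_ne_one this
  have hn := hp'.null
  rw [hvt] at hn
  simp only [map_add, map_smul, add_apply, smul_apply,
    smul_eq_mul, mem_inducedRadical.1 hv, hp.null, h.symm N] at hn
  have hvN : G (A v) N = 0 := by
    have : t * G (A v) N = 0 := by linarith
    exact (mul_eq_zero.1 this).resolve_left ht
  refine ⟨t, ?_⟩
  rw [hvt, h.eq_smul_of_mem_radical hp hv, hvN, zero_smul, map_zero, zero_add]

/-- Replaces the chosen projection by an explicit formula that depends smoothly on `A` and `N`. The
two agree because their values on `A v` and on `N` are prescribed, and these span. -/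
theorem tangentialProjection_eq (h : IsLightlike G A S) (hp : IsNormalizingPair G A S ξ N) :
    tangentialProjection G A S =
      ContinuousLinearMap.fst ℝ E ℝ ∘L (transversalMap A N).inverse := by
  have hξ : ξ ∈ inducedRadical G A := mem_inducedRadical.2 hp.radical
  have hinv := h.isInvertible_transversalMap hξ (by rw [hp.pairing]; exact one_ne_zero)
  have hT : ∀ v t, (transversalMap A N).inverse (A v + t • N) = (v, t) := by
    intro v t
    rw [← transversalMap_apply, hinv.inverse_apply_self]
  have hex : ∃ T : E' →L[ℝ] E, (∀ v, T (A v) = v) ∧ ∀ N ∈ lightlikeTransversal G A S, T N = 0 := by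
    refine ⟨ContinuousLinearMap.fst ℝ E ℝ ∘L (transversalMap A N).inverse, fun v ↦ ?_, ?_⟩
    · have := hT v 0
      rw [zero_smul, add_zero] at this
      simp [this]
    · intro N' hN'
      induction hN' using Submodule.span_induction with
      | mem N' h' =>
        obtain ⟨ξ', hp'⟩ := h'
        obtain ⟨t, rfl⟩ := h.eq_smul_of_mem_transversal hp hp'
        have := hT 0 t
        rw [map_zero, zero_add] at this
        rw [ContinuousLinearMap.comp_apply, this]
        rfl
      | zero => exact map_zero _
      | add x y _ _ hx hy => rw [map_add, hx, hy, add_zero]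
      | smul r x _ hx => rw [map_smul, hx, smul_zero]
  rw [tangentialProjection, dif_pos hex]
  ext w
  obtain ⟨v, t, rfl⟩ := h.exists_decomposition hξ (by rw [hp.pairing]; exact one_ne_zero) w
  rw [ContinuousLinearMap.comp_apply, hT, map_add, map_smul, hex.choose_spec.1,
    hex.choose_spec.2 N (Submodule.subset_span ⟨ξ, hp⟩), smul_zero, add_zero]
  rfl

end IsLightlike

/-! ### Normalizing pairs from approximate data -/

variable {K : Type*} [NormedAddCommGroup K] [NormedSpace ℝ K]

/-- The Gram form of the frame `σ`. -/
def gram (G : E' →L[ℝ] E' →L[ℝ] ℝ) (A : E →L[ℝ] E') (σ : K →L[ℝ] E) : K →L[ℝ] K →L[ℝ] ℝ :=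
  G.bilinearComp (A ∘L σ) (A ∘L σ)

/-- The orthogonal projection to the span of the frame `σ`. -/
def frameProjection (G : E' →L[ℝ] E' →L[ℝ] ℝ) (A : E →L[ℝ] E') (σ : K →L[ℝ] E) : E' →L[ℝ] E :=
  σ ∘L (gram G A σ).inverse ∘L G.bilinearComp (.id ℝ E') (A ∘L σ)

/-- The component of `ξ₀` orthogonal to the frame. -/
def correctedRadical (G : E' →L[ℝ] E' →L[ℝ] ℝ) (A : E →L[ℝ] E') (σ : K →L[ℝ] E) (ξ₀ : E) : E :=
  ξ₀ - frameProjection G A σ (A ξ₀)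

/-- The component of `N₀` orthogonal to the frame. -/
def screenNormal (G : E' →L[ℝ] E' →L[ℝ] ℝ) (A : E →L[ℝ] E') (σ : K →L[ℝ] E) (N₀ : E') : E' :=
  N₀ - A (frameProjection G A σ N₀)

/-- The null vector normalized against `correctedRadical`. -/
def correctedNormal (G : E' →L[ℝ] E' →L[ℝ] ℝ) (A : E →L[ℝ] E') (σ : K →L[ℝ] E) (ξ₀ : E)
    (N₀ : E') : E' :=
  let ξ := A (correctedRadical G A σ ξ₀)
  let W := screenNormal G A σ N₀
  (G ξ W)⁻¹ • (W - (G W W * (2 * G ξ W)⁻¹) • ξ)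

section Frame

variable {G : E' →L[ℝ] E' →L[ℝ] ℝ} {A : E →L[ℝ] E'} {σ : K →L[ℝ] E}

theorem frameProjection_orthogonal (hi : (gram G A σ).IsInvertible) (w : E') (k : K) :
    G (A (frameProjection G A σ w)) (A (σ k)) = G w (A (σ k)) := by
  have := hi.self_apply_inverse (G.bilinearComp (.id ℝ E') (A ∘L σ) w)
  simpa [gram, frameProjection] using DFunLike.congr_fun this k

theorem frameProjection_eq_zero {w : E'} (hw : ∀ k, G w (A (σ k)) = 0) :
    frameProjection G A σ w = 0 := by
  have : G.bilinearComp (.id ℝ E') (A ∘L σ) w = 0 := by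
    ext k
    simpa using hw k
  rw [frameProjection, ContinuousLinearMap.comp_apply, ContinuousLinearMap.comp_apply, this,
    map_zero, map_zero]

/-- A tangent vector orthogonal to the screen is radical. Subtracting `λ ξ` from `W` changes `G(W,
W)` by `-2λ G(ξ, W)`, which dictates the coefficient in `correctedNormal`; dividing by `G(ξ, W)`
normalizes the pairing. -/
theorem isNormalizingPair_corrected {S : Submodule ℝ E} (h : IsLightlike G A S)
    (hi : (gram G A σ).IsInvertible) (hσ : LinearMap.range σ.toLinearMap = S) {ξ₀ : E} {N₀ : E'}
    (hβ : G (A (correctedRadical G A σ ξ₀)) (screenNormal G A σ N₀) ≠ 0) :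
    IsNormalizingPair G A S (correctedRadical G A σ ξ₀) (correctedNormal G A σ ξ₀ N₀) := by
  have hmem : ∀ s ∈ S, ∃ k, σ k = s := by
    intro s hs
    rw [← hσ] at hs
    exact hs
  have hrad : ∀ v, G (A (correctedRadical G A σ ξ₀)) (A v) = 0 := by
    refine mem_inducedRadical.1 (h.mem_radical_of_orthogonal fun s hs ↦ ?_)
    obtain ⟨k, rfl⟩ := hmem s hs
    rw [correctedRadical, map_sub, map_sub, sub_apply,
      frameProjection_orthogonal hi, sub_self]
  have hW : ∀ s ∈ S, G (A s) (screenNormal G A σ N₀) = 0 := by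
    intro s hs
    obtain ⟨k, rfl⟩ := hmem s hs
    rw [h.symm, screenNormal, map_sub, sub_apply,
      frameProjection_orthogonal hi, sub_self]
  unfold correctedNormal
  set ξ := correctedRadical G A σ ξ₀
  set W := screenNormal G A σ N₀
  refine ⟨hrad, ?_, ?_, fun s hs ↦ ?_⟩
  · simp [hrad, hβ]
  · simp only [map_smul, map_sub, smul_apply, sub_apply, smul_eq_mul, hrad, h.symm W (A ξ)]
    field_simp
    ring
  · simp [hW s hs, h.symm (A s) (A ξ), hrad]

theorem correctedRadical_eq {ξ₀ : E} (h : ∀ v, G (A ξ₀) (A v) = 0) :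
    correctedRadical G A σ ξ₀ = ξ₀ := by
  rw [correctedRadical, frameProjection_eq_zero fun k ↦ h _, sub_zero]

end Frame

theorem IsLightlike.isInvertible_gram [FiniteDimensional ℝ E] {G : E' →L[ℝ] E' →L[ℝ] ℝ}
    {A : E →L[ℝ] E'} {S : Submodule ℝ E} (h : IsLightlike G A S) :
    (gram G A S.subtypeL).IsInvertible := by
  refine isInvertible_of_nondegenerate _ fun v hv ↦ ?_
  exact Subtype.ext (h.eq_zero_of_orthogonal v.2 fun s hs ↦ by simpa [gram] using hv ⟨s, hs⟩)

/-- Any nonzero radical `ξ` and any `N` not orthogonal to `A ξ` can be corrected: `ξ` is left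
unchanged, and removing the screen part of `N` does not affect their pairing. -/
theorem IsLightlike.exists_isNormalizingPair [FiniteDimensional ℝ E] {G : E' →L[ℝ] E' →L[ℝ] ℝ}
    {A : E →L[ℝ] E'} {S : Submodule ℝ E} (h : IsLightlike G A S) :
    ∃ ξ N, IsNormalizingPair G A S ξ N := by
  obtain ⟨ξ, hξ, hξ0⟩ := Submodule.exists_mem_ne_zero_of_ne_bot h.degenerate
  have hA : A ξ ≠ 0 := fun h0 ↦ hξ0 ((injective_iff_map_eq_zero A).1 h.injective ξ h0)
  obtain ⟨N, hN⟩ : ∃ N, G (A ξ) N ≠ 0 := by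
    by_contra! hN
    exact hA (h.nondegenerate _ hN)
  have hr := mem_inducedRadical.1 hξ
  refine ⟨_, _, isNormalizingPair_corrected (σ := S.subtypeL) (ξ₀ := ξ) (N₀ := N) h
    h.isInvertible_gram (by simp) ?_⟩
  rw [correctedRadical_eq hr, screenNormal, map_sub, hr, sub_zero]
  exact hN

/-- The radical is a line. This gives nearby screens equal dimension, so an injective frame with
values in the screen spans it. -/
theorem IsLightlike.finrank_screen [FiniteDimensional ℝ E] [FiniteDimensional ℝ E']
    {G : E' →L[ℝ] E' →L[ℝ] ℝ}
    {A : E →L[ℝ] E'} {S : Submodule ℝ E} (h : IsLightlike G A S) :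
    Module.finrank ℝ S + 1 = Module.finrank ℝ E := by
  obtain ⟨ξ, N, hp⟩ := h.exists_isNormalizingPair
  have hspan : inducedRadical G A = Submodule.span ℝ {ξ} := by
    apply le_antisymm
    · intro r hr
      rw [h.eq_smul_of_mem_radical hp hr]
      exact Submodule.smul_mem _ _ (Submodule.mem_span_singleton_self ξ)
    · rw [Submodule.span_singleton_le_iff_mem]
      exact mem_inducedRadical.2 hp.radical
  have hξ : ξ ≠ 0 := by
    rintro rfl
    simpa using hp.pairing
  rw [← Submodule.finrank_add_eq_of_isCompl h.isCompl, hspan, finrank_span_singleton hξ]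

end LightlikeAlgebra

/-! ### Smooth local frames of the screen and smooth normalizing pairs. -/

section SmoothFrame

variable {X : Type*} [NormedAddCommGroup X] [NormedSpace ℝ X]
  {V₁ V₂ V₃ V₄ W : Type*} [NormedAddCommGroup V₁] [NormedSpace ℝ V₁]
  [NormedAddCommGroup V₂] [NormedSpace ℝ V₂] [NormedAddCommGroup V₃] [NormedSpace ℝ V₃]
  [NormedAddCommGroup V₄] [NormedSpace ℝ V₄] [NormedAddCommGroup W] [NormedSpace ℝ W]

theorem contDiffAt_flip {B : X → V₁ →L[ℝ] V₂ →L[ℝ] W} {x : X} (hB : ContDiffAt ℝ ∞ B x) :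
    ContDiffAt ℝ ∞ (fun x ↦ (B x).flip) x :=
  (ContinuousLinearMap.flipₗᵢ ℝ V₁ V₂ W).contDiff.contDiffAt.comp x hB

theorem contDiffAt_bilinearComp {B : X → V₁ →L[ℝ] V₂ →L[ℝ] W} {C : X → V₃ →L[ℝ] V₁}
    {D : X → V₄ →L[ℝ] V₂} {x : X} (hB : ContDiffAt ℝ ∞ B x) (hC : ContDiffAt ℝ ∞ C x)
    (hD : ContDiffAt ℝ ∞ D x) :
    ContDiffAt ℝ ∞ (fun x ↦ (B x).bilinearComp (C x) (D x)) x :=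
  contDiffAt_flip ((contDiffAt_flip (hB.clm_comp hC)).clm_comp hD)

theorem contDiffAt_inverse [CompleteSpace V₁] {B : X → V₁ →L[ℝ] V₂} {x : X}
    (hB : ContDiffAt ℝ ∞ B x) (hi : (B x).IsInvertible) :
    ContDiffAt ℝ ∞ (fun x ↦ (B x).inverse) x :=
  ContDiffAt.comp (f := B) (g := ContinuousLinearMap.inverse) x hi.contDiffAt_map_inverse hB

variable {E : Type*} [NormedAddCommGroup E] [NormedSpace ℝ E] [FiniteDimensional ℝ E]
  {E' : Type*} [NormedAddCommGroup E'] [NormedSpace ℝ E'] [FiniteDimensional ℝ E']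
  {K : Type*} [NormedAddCommGroup K] [NormedSpace ℝ K] [FiniteDimensional ℝ K]
  {G : X → E' →L[ℝ] E' →L[ℝ] ℝ} {A : X → E →L[ℝ] E'} {σ : X → K →L[ℝ] E} {x₀ : X}

omit [FiniteDimensional ℝ E] [FiniteDimensional ℝ E'] [FiniteDimensional ℝ K] in
theorem contDiffAt_gram (hG : ContDiffAt ℝ ∞ G x₀) (hA : ContDiffAt ℝ ∞ A x₀)
    (hσ : ContDiffAt ℝ ∞ σ x₀) : ContDiffAt ℝ ∞ (fun x ↦ gram (G x) (A x) (σ x)) x₀ :=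
  contDiffAt_bilinearComp hG (hA.clm_comp hσ) (hA.clm_comp hσ)

omit [FiniteDimensional ℝ E] [FiniteDimensional ℝ E'] in
theorem contDiffAt_frameProjection (hG : ContDiffAt ℝ ∞ G x₀) (hA : ContDiffAt ℝ ∞ A x₀)
    (hσ : ContDiffAt ℝ ∞ σ x₀) (hi : (gram (G x₀) (A x₀) (σ x₀)).IsInvertible) :
    ContDiffAt ℝ ∞ (fun x ↦ frameProjection (G x) (A x) (σ x)) x₀ := by
  have : CompleteSpace K := FiniteDimensional.complete ℝ K
  have hI : ContDiffAt ℝ ∞ (fun x ↦ (gram (G x) (A x) (σ x)).inverse) x₀ :=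
    contDiffAt_inverse (contDiffAt_gram hG hA hσ) hi
  exact hσ.clm_comp (hI.clm_comp
    (contDiffAt_bilinearComp hG contDiffAt_const (hA.clm_comp hσ)))

omit [FiniteDimensional ℝ E] [FiniteDimensional ℝ E'] in
theorem contDiffAt_correctedRadical (hG : ContDiffAt ℝ ∞ G x₀) (hA : ContDiffAt ℝ ∞ A x₀)
    (hσ : ContDiffAt ℝ ∞ σ x₀) (hi : (gram (G x₀) (A x₀) (σ x₀)).IsInvertible) (ξ₀ : E) :
    ContDiffAt ℝ ∞ (fun x ↦ correctedRadical (G x) (A x) (σ x) ξ₀) x₀ :=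
  contDiffAt_const.sub
    ((contDiffAt_frameProjection hG hA hσ hi).clm_apply (hA.clm_apply contDiffAt_const))

omit [FiniteDimensional ℝ E] [FiniteDimensional ℝ E'] in
theorem contDiffAt_screenNormal (hG : ContDiffAt ℝ ∞ G x₀) (hA : ContDiffAt ℝ ∞ A x₀)
    (hσ : ContDiffAt ℝ ∞ σ x₀) (hi : (gram (G x₀) (A x₀) (σ x₀)).IsInvertible) (N₀ : E') :
    ContDiffAt ℝ ∞ (fun x ↦ screenNormal (G x) (A x) (σ x) N₀) x₀ :=
  contDiffAt_const.sub
    (hA.clm_apply ((contDiffAt_frameProjection hG hA hσ hi).clm_apply contDiffAt_const))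

omit [FiniteDimensional ℝ E] [FiniteDimensional ℝ E'] in
theorem contDiffAt_correctedNormal (hG : ContDiffAt ℝ ∞ G x₀) (hA : ContDiffAt ℝ ∞ A x₀)
    (hσ : ContDiffAt ℝ ∞ σ x₀) (hi : (gram (G x₀) (A x₀) (σ x₀)).IsInvertible) {ξ₀ : E} {N₀ : E'}
    (hβ : G x₀ (A x₀ (correctedRadical (G x₀) (A x₀) (σ x₀) ξ₀))
      (screenNormal (G x₀) (A x₀) (σ x₀) N₀) ≠ 0) :
    ContDiffAt ℝ ∞ (fun x ↦ correctedNormal (G x) (A x) (σ x) ξ₀ N₀) x₀ := by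
  have hξ := hA.clm_apply (contDiffAt_correctedRadical hG hA hσ hi ξ₀)
  have hW := contDiffAt_screenNormal hG hA hσ hi N₀
  have hp := (hG.clm_apply hξ).clm_apply hW
  exact (hp.inv hβ).smul (hW.sub ((((hG.clm_apply hW).clm_apply hW).mul
    ((contDiffAt_const.mul hp).inv (mul_ne_zero two_ne_zero hβ))).smul hξ))

/-- A normalizing pair at a point extends to a smooth family of normalizing pairs. -/
theorem exists_smooth_isNormalizingPair {S : X → Submodule ℝ E} (hG : ContDiffAt ℝ ∞ G x₀)
    (hA : ContDiffAt ℝ ∞ A x₀) (hL : ∀ᶠ x in 𝓝 x₀, IsLightlike (G x) (A x) (S x))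
    (hS : ∀ v ∈ S x₀, ∃ Y : X → E, ContDiffAt ℝ ∞ Y x₀ ∧ (∀ᶠ x in 𝓝 x₀, Y x ∈ S x) ∧ Y x₀ = v)
    {ξ₀ : E} {N₀ : E'} (hp : IsNormalizingPair (G x₀) (A x₀) (S x₀) ξ₀ N₀) :
    ∃ (ξ : X → E) (N : X → E'), ContDiffAt ℝ ∞ N x₀ ∧ N x₀ = N₀ ∧
      ∀ᶠ x in 𝓝 x₀, IsNormalizingPair (G x) (A x) (S x) (ξ x) (N x) := by
  have hL₀ := hL.self_of_nhds
  let e := Module.finBasis ℝ (S x₀)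
  choose Y hYs hYm hY0 using fun i ↦ hS (e i) (e i).2
  -- The frame: local smooth sections through a basis of `S x₀`, assembled so that `σ x₀` is the
  -- inclusion.
  let σ : X → S x₀ →L[ℝ] E := fun x ↦
    ∑ i, (LinearMap.toContinuousLinearMap (e.coord i)).smulRight (Y i x)
  have hσ_apply : ∀ x k, σ x k = ∑ i, e.repr k i • Y i x := by
    intro x k
    simp [σ]
  have hσ0 : σ x₀ = (S x₀).subtypeL := by
    ext k
    rw [hσ_apply]
    simp only [hY0]
    have := congrArg (S x₀).subtype (e.sum_repr k)
    simp only [map_sum, map_smul, Submodule.subtype_apply] at this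
    exact this
  have hσs : ContDiffAt ℝ ∞ σ x₀ := by
    refine ContDiffAt.sum fun i _ ↦ ?_
    exact (ContinuousLinearMap.smulRightL ℝ (S x₀) E
      (LinearMap.toContinuousLinearMap (e.coord i))).contDiff.contDiffAt.comp x₀ (hYs i)
  have hi₀ : (gram (G x₀) (A x₀) (σ x₀)).IsInvertible := by
    rw [hσ0]
    exact hL₀.isInvertible_gram
  have : CompleteSpace (S x₀) := FiniteDimensional.complete ℝ _
  have hi : ∀ᶠ x in 𝓝 x₀, (gram (G x) (A x) (σ x)).IsInvertible := by
    obtain ⟨g₀, hg₀⟩ := hi₀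
    have := (contDiffAt_gram hG hA hσs).continuousAt.eventually
      (hg₀ ▸ ContinuousLinearEquiv.nhds g₀)
    filter_upwards [this] with x hx
    exact hx
  -- Invertibility of the Gram form makes `σ x` injective, and the dimension count makes it onto the
  -- screen.
  have hrange : ∀ᶠ x in 𝓝 x₀, LinearMap.range (σ x).toLinearMap = S x := by
    filter_upwards [hi, hL, Filter.eventually_all.2 hYm] with x hix hLx hYx
    refine Submodule.eq_of_le_of_finrank_eq ?_ ?_
    · rintro _ ⟨k, rfl⟩
      rw [ContinuousLinearMap.coe_coe, hσ_apply]
      exact Submodule.sum_mem _ fun i _ ↦ Submodule.smul_mem _ _ (hYx i)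
    · have hinj : Function.Injective (σ x).toLinearMap := by
        rw [injective_iff_map_eq_zero]
        intro k hk
        apply hix.injective
        rw [map_zero]
        ext l
        have hk' : σ x k = 0 := hk
        simp [gram, hk']
      rw [LinearMap.finrank_range_of_inj hinj]
      have := hLx.finrank_screen
      have := hL₀.finrank_screen
      omega
  -- At `x₀` the given pair is already orthogonal to the frame, so the corrections leave it
  -- unchanged.
  have hξ0 : correctedRadical (G x₀) (A x₀) (σ x₀) ξ₀ = ξ₀ := correctedRadical_eq hp.radical
  have hW0 : screenNormal (G x₀) (A x₀) (σ x₀) N₀ = N₀ := by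
    rw [screenNormal, frameProjection_eq_zero, map_zero, sub_zero]
    intro k
    rw [hL₀.symm, hσ0]
    exact hp.orthogonal _ k.2
  have hβ0 : G x₀ (A x₀ (correctedRadical (G x₀) (A x₀) (σ x₀) ξ₀))
      (screenNormal (G x₀) (A x₀) (σ x₀) N₀) ≠ 0 := by
    rw [hξ0, hW0, hp.pairing]
    exact one_ne_zero
  have hβ := ((hG.clm_apply (hA.clm_apply (contDiffAt_correctedRadical hG hA hσs hi₀ ξ₀))).clm_apply
    (contDiffAt_screenNormal hG hA hσs hi₀ N₀)).continuousAt.eventually_ne hβ0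
  refine ⟨fun x ↦ correctedRadical (G x) (A x) (σ x) ξ₀,
    fun x ↦ correctedNormal (G x) (A x) (σ x) ξ₀ N₀,
    contDiffAt_correctedNormal hG hA hσs hi₀ hβ0, ?_, ?_⟩
  · simp [correctedNormal, hξ0, hW0, hp.pairing, hp.null]
  · filter_upwards [hi, hL, hrange, hβ] with x hix hLx hrx hβx
    exact isNormalizingPair_corrected hLx hix hrx hβx

end SmoothFrame

/-! ### The Gauss formula and the transversal component of the Gauss equation. -/

section Gauss

variable {E : Type*} [NormedAddCommGroup E] [NormedSpace ℝ E] [FiniteDimensional ℝ E]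
  {E' : Type*} [NormedAddCommGroup E'] [NormedSpace ℝ E'] [FiniteDimensional ℝ E']
  {G : E' → E' →L[ℝ] E' →L[ℝ] ℝ} {f : E → E'} {S : E → Submodule ℝ E} {x₀ : E}

omit [FiniteDimensional ℝ E] in
theorem contDiffAt_derivAlong (hG : IsMetricNear G (f x₀)) (hf : ContDiffAt ℝ ∞ f x₀) :
    ContDiffAt ℝ ∞ (derivAlong G f) x₀ := by
  have hf1 : ContDiffAt ℝ ∞ (fderiv ℝ f) x₀ := hf.fderiv_right (by simp)
  have hf2 : ContDiffAt ℝ ∞ (fderiv ℝ (fderiv ℝ f)) x₀ := hf1.fderiv_right (by simp)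
  exact hf2.add (contDiffAt_bilinearComp (hG.contDiffAt_christoffel.comp x₀ hf) hf1 hf1)

/-- The decomposition `∇̄_b (df c) = df(Γ(b, c)) + B(b, c) N` with smooth coefficients. -/
theorem exists_gauss_formula (hG : IsMetricNear G (f x₀)) (hf : ContDiffAt ℝ ∞ f x₀)
    (hL : ∀ᶠ x in 𝓝 x₀, IsLightlike (G (f x)) (fderiv ℝ f x) (S x)) {ξ : E → E} {N : E → E'}
    (hN : ContDiffAt ℝ ∞ N x₀)
    (hp : ∀ᶠ x in 𝓝 x₀, IsNormalizingPair (G (f x)) (fderiv ℝ f x) (S x) (ξ x) (N x)) :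
    ContDiffAt ℝ ∞ (inducedChristoffel G f S) x₀ ∧ ∃ B : E → E →L[ℝ] E →L[ℝ] ℝ,
      ContDiffAt ℝ ∞ B x₀ ∧ ∀ᶠ x in 𝓝 x₀, ∀ b c,
        derivAlong G f x b c =
          fderiv ℝ f x (inducedChristoffel G f S x b c) + B x b c • N x := by
  have hf1 : ContDiffAt ℝ ∞ (fderiv ℝ f) x₀ := hf.fderiv_right (by simp)
  have hH := contDiffAt_derivAlong hG hf
  have : CompleteSpace E := FiniteDimensional.complete ℝ E
  have hM : ContDiffAt ℝ ∞ (fun x ↦ IsLightlike.transversalMap (fderiv ℝ f x) (N x)) x₀ := by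
    have h1 : (fun x ↦ IsLightlike.transversalMap (fderiv ℝ f x) (N x)) = fun x ↦
        fderiv ℝ f x ∘L ContinuousLinearMap.fst ℝ E ℝ +
          (ContinuousLinearMap.smulRightL ℝ (E × ℝ) E' (ContinuousLinearMap.snd ℝ E ℝ)) (N x) := by
      funext x
      ext <;> simp [IsLightlike.transversalMap_apply]
    rw [h1]
    exact (hf1.clm_comp contDiffAt_const).add
      ((ContinuousLinearMap.contDiff _).contDiffAt.comp x₀ hN)
  have hinv : ∀ᶠ x in 𝓝 x₀, (IsLightlike.transversalMap (fderiv ℝ f x) (N x)).IsInvertible := by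
    filter_upwards [hL, hp] with x hLx hpx
    exact hLx.isInvertible_transversalMap (mem_inducedRadical.2 hpx.radical)
      (by rw [hpx.pairing]; exact one_ne_zero)
  have hI : ContDiffAt ℝ ∞
      (fun x ↦ (IsLightlike.transversalMap (fderiv ℝ f x) (N x)).inverse) x₀ :=
    contDiffAt_inverse hM hinv.self_of_nhds
  have hΓ : inducedChristoffel G f S =ᶠ[𝓝 x₀] fun x ↦
      (ContinuousLinearMap.compL ℝ E E' E (ContinuousLinearMap.fst ℝ E ℝ ∘L
        (IsLightlike.transversalMap (fderiv ℝ f x) (N x)).inverse)) ∘L derivAlong G f x := by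
    filter_upwards [hL, hp] with x hLx hpx
    rw [inducedChristoffel, hLx.tangentialProjection_eq hpx]
  refine ⟨ContDiffAt.congr_of_eventuallyEq ?_ hΓ, fun x ↦
      (ContinuousLinearMap.compL ℝ E E' ℝ (ContinuousLinearMap.snd ℝ E ℝ ∘L
        (IsLightlike.transversalMap (fderiv ℝ f x) (N x)).inverse)) ∘L derivAlong G f x, ?_, ?_⟩
  · exact ((ContinuousLinearMap.compL ℝ E E' E).contDiff.contDiffAt.comp x₀
      (contDiffAt_const.clm_comp hI)).clm_comp hH
  · exact ((ContinuousLinearMap.compL ℝ E E' ℝ).contDiff.contDiffAt.comp x₀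
      (contDiffAt_const.clm_comp hI)).clm_comp hH
  · filter_upwards [hΓ, hinv] with x hx hix b c
    rw [hx]
    have := hix.self_apply_inverse (derivAlong G f x b c)
    rw [← Prod.mk.eta (p := (IsLightlike.transversalMap (fderiv ℝ f x) (N x)).inverse _),
      IsLightlike.transversalMap_apply] at this
    exact this.symm

omit [FiniteDimensional ℝ E] in
/-- The derivative of a null vector field along a map is orthogonal to it. -/
theorem null_derivative_orthogonal (hG : IsMetricNear G (f x₀)) (hf : DifferentiableAt ℝ f x₀)
    {N : E → E'} (hN : DifferentiableAt ℝ N x₀) (h0 : ∀ᶠ x in 𝓝 x₀, G (f x) (N x) (N x) = 0)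
    (a : E) :
    G (f x₀) (fderiv ℝ N x₀ a + christoffel G (f x₀) (fderiv ℝ f x₀ a) (N x₀)) (N x₀) = 0 := by
  have hGf : DifferentiableAt ℝ (fun x ↦ G (f x)) x₀ := hG.differentiableAt.comp x₀ hf
  have hGN : DifferentiableAt ℝ (fun x ↦ G (f x) (N x)) x₀ := hGf.clm_apply hN
  -- Differentiating `G(N, N) = 0` gives `2 G(∇̄_a N, N) = 0` by metric compatibility.
  have h := Filter.EventuallyEq.fderiv_eq (𝕜 := ℝ) (f := fun _ ↦ (0 : ℝ)) h0
  have h1 : fderiv ℝ (fun x ↦ G (f x)) x₀ a = fderiv ℝ G (f x₀) (fderiv ℝ f x₀ a) := by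
    have := fderiv_comp x₀ hG.differentiableAt hf
    rw [Function.comp_def] at this
    rw [this]
    rfl
  rw [fderiv_clm_apply hGN hN, fderiv_clm_apply hGf hN] at h
  replace h := DFunLike.congr_fun h a
  simp only [add_apply, ContinuousLinearMap.comp_apply, ContinuousLinearMap.flip_apply, h1,
    hG.fderiv_eq_christoffel, fderiv_fun_const, Pi.zero_apply, zero_apply] at h
  have s := hG.symm.self_of_nhds
  rw [s (N x₀) (fderiv ℝ N x₀ a), s (N x₀) (christoffel G (f x₀) _ _)] at h
  rw [map_add, add_apply]
  linarith

/-- The transversal component of the Gauss equation: `ḡ(R(a,b)c, N) = ḡ(R̄(a,b)c, N)`. -/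
theorem gauss_equation (hG : IsMetricNear G (f x₀)) (hf : ContDiffAt ℝ ∞ f x₀)
    (hL : ∀ᶠ x in 𝓝 x₀, IsLightlike (G (f x)) (fderiv ℝ f x) (S x))
    (hS : ∀ v ∈ S x₀, ∃ Y : E → E, ContDiffAt ℝ ∞ Y x₀ ∧ (∀ᶠ x in 𝓝 x₀, Y x ∈ S x) ∧ Y x₀ = v)
    {ξ₀ : E} {N₀ : E'} (hp₀ : IsNormalizingPair (G (f x₀)) (fderiv ℝ f x₀) (S x₀) ξ₀ N₀)
    (a b c : E) :
    G (f x₀) (fderiv ℝ f x₀ (coordCurvature (inducedChristoffel G f S) x₀ a b c)) N₀ =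
      G (f x₀) (coordCurvature (christoffel G) (f x₀) (fderiv ℝ f x₀ a) (fderiv ℝ f x₀ b)
        (fderiv ℝ f x₀ c)) N₀ := by
  have hf1 : ContDiffAt ℝ ∞ (fderiv ℝ f) x₀ := hf.fderiv_right (by simp)
  have hf2 : ContDiffAt ℝ ∞ (fderiv ℝ (fderiv ℝ f)) x₀ := hf1.fderiv_right (by simp)
  have hGf : ContDiffAt ℝ ∞ (fun x ↦ G (f x)) x₀ := hG.contDiffAt.comp x₀ hf
  obtain ⟨ξ, N, hN, hN0, hp⟩ := exists_smooth_isNormalizingPair hGf hf1 hL hS hp₀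
  obtain ⟨hΓ, B, hB, hdec⟩ := exists_gauss_formula hG hf hL hN hp
  have hdf : DifferentiableAt ℝ f x₀ := hf.differentiableAt (by simp)
  have hd1 : DifferentiableAt ℝ (fderiv ℝ f) x₀ := hf1.differentiableAt (by simp)
  have hd2 : DifferentiableAt ℝ (fderiv ℝ (fderiv ℝ f)) x₀ := hf2.differentiableAt (by simp)
  have hdN : DifferentiableAt ℝ N x₀ := hN.differentiableAt (by simp)
  have hdB : DifferentiableAt ℝ B x₀ := hB.differentiableAt (by simp)
  have hdΓ : DifferentiableAt ℝ (inducedChristoffel G f S) x₀ := hΓ.differentiableAt (by simp)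
  have hdC : DifferentiableAt ℝ (fun x ↦ christoffel G (f x)) x₀ :=
    hG.differentiableAt_christoffel.comp x₀ hdf
  have hC1 : ∀ a, fderiv ℝ (fun x ↦ christoffel G (f x)) x₀ a =
      fderiv ℝ (christoffel G) (f x₀) (fderiv ℝ f x₀ a) := by
    intro a
    have := fderiv_comp x₀ hG.differentiableAt_christoffel hdf
    rw [Function.comp_def] at this
    rw [this]
    rfl
  have hnull := null_derivative_orthogonal hG hdf hdN (hp.mono fun x hx ↦ hx.null)
  set Γ := inducedChristoffel G f S
  set C := christoffel G
  set D := fderiv ℝ f x₀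
  set D2 := fderiv ℝ (fderiv ℝ f) x₀
  set D3 := fderiv ℝ (fderiv ℝ (fderiv ℝ f)) x₀
  -- The derivative of `∇̄_b df(c)` is computed twice: here from its definition, next from its Gauss
  -- decomposition.
  have hleft : ∀ a b c, fderiv ℝ (fun x ↦ derivAlong G f x b c) x₀ a =
      D3 a b c + (fderiv ℝ C (f x₀) (D a) (D b) (D c) + C (f x₀) (D2 a b) (D c) +
        C (f x₀) (D b) (D2 a c)) := by
    intro a b c
    have hfb : DifferentiableAt ℝ (fun x ↦ fderiv ℝ f x b) x₀ := by fun_prop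
    have hfc : DifferentiableAt ℝ (fun x ↦ fderiv ℝ f x c) x₀ := by fun_prop
    have hCb : DifferentiableAt ℝ (fun x ↦ C (f x) (fderiv ℝ f x b)) x₀ := hdC.clm_apply hfb
    have hCbc : DifferentiableAt ℝ (fun x ↦ C (f x) (fderiv ℝ f x b) (fderiv ℝ f x c)) x₀ :=
      hCb.clm_apply hfc
    have hDb : DifferentiableAt ℝ (fun x ↦ fderiv ℝ (fderiv ℝ f) x b) x₀ := by fun_prop
    have hDbc : DifferentiableAt ℝ (fun x ↦ fderiv ℝ (fderiv ℝ f) x b c) x₀ := by fun_prop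
    have e : (fun x ↦ derivAlong G f x b c) = fun x ↦ fderiv ℝ (fderiv ℝ f) x b c +
        C (f x) (fderiv ℝ f x b) (fderiv ℝ f x c) := rfl
    rw [e, fderiv_fun_add hDbc hCbc, fderiv_clm_apply hDb (by fun_prop),
      fderiv_clm_apply hd2 (by fun_prop), fderiv_clm_apply hCb hfc, fderiv_clm_apply hdC hfb,
      fderiv_clm_apply hd1 (by fun_prop), fderiv_clm_apply hd1 (by fun_prop)]
    simp only [fderiv_fun_const, Pi.zero_apply, ContinuousLinearMap.comp_zero, zero_add,
      add_apply, ContinuousLinearMap.comp_apply, ContinuousLinearMap.flip_apply, hC1]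
    abel
  have hright : ∀ a b c, fderiv ℝ (fun x ↦ derivAlong G f x b c) x₀ a =
      D2 a (Γ x₀ b c) + D (fderiv ℝ Γ x₀ a b c) + fderiv ℝ B x₀ a b c • N x₀ +
        B x₀ b c • fderiv ℝ N x₀ a := by
    intro a b c
    have e : (fun x ↦ derivAlong G f x b c) =ᶠ[𝓝 x₀]
        fun x ↦ fderiv ℝ f x (Γ x b c) + B x b c • N x := hdec.mono fun x hx ↦ hx b c
    have hΓb : DifferentiableAt ℝ (fun x ↦ Γ x b) x₀ := by fun_prop
    have hΓbc : DifferentiableAt ℝ (fun x ↦ Γ x b c) x₀ := by fun_prop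
    have hBb : DifferentiableAt ℝ (fun x ↦ B x b) x₀ := by fun_prop
    have hBbc : DifferentiableAt ℝ (fun x ↦ B x b c) x₀ := by fun_prop
    have hBN : DifferentiableAt ℝ (fun x ↦ B x b c • N x) x₀ := hBbc.smul hdN
    rw [e.fderiv_eq, fderiv_fun_add (hd1.clm_apply hΓbc) hBN,
      fderiv_clm_apply hd1 hΓbc, fderiv_clm_apply hΓb (by fun_prop),
      fderiv_clm_apply hdΓ (by fun_prop), fderiv_fun_smul hBbc hdN,
      fderiv_clm_apply hBb (by fun_prop), fderiv_clm_apply hdB (by fun_prop)]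
    simp only [fderiv_fun_const, Pi.zero_apply, ContinuousLinearMap.comp_zero, zero_add,
      add_apply, smul_apply, ContinuousLinearMap.comp_apply, ContinuousLinearMap.flip_apply,
      ContinuousLinearMap.smulRight_apply]
    abel
  have hdec₀ : ∀ b c, D2 b c + C (f x₀) (D b) (D c) = D (Γ x₀ b c) + B x₀ b c • N x₀ :=
    hdec.self_of_nhds
  -- Pairing `∇̄_a ∇̄_b df(c)` with `N` keeps only the tangential part: the multiples of `N` and of
  -- `∇̄_a N` are orthogonal to `N`.
  have hpair : ∀ a b c, G (f x₀) (D3 a b c + (fderiv ℝ C (f x₀) (D a) (D b) (D c) +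
      C (f x₀) (D2 a b) (D c) + C (f x₀) (D b) (D2 a c)) +
        C (f x₀) (D a) (D2 b c + C (f x₀) (D b) (D c))) (N x₀) =
      G (f x₀) (D (fderiv ℝ Γ x₀ a b c + Γ x₀ a (Γ x₀ b c))) (N x₀) := by
    intro a b c
    have hNN : G (f x₀) (N x₀) (N x₀) = 0 := hp.self_of_nhds.null
    have key : D2 a (Γ x₀ b c) + D (fderiv ℝ Γ x₀ a b c) + fderiv ℝ B x₀ a b c • N x₀ +
        B x₀ b c • fderiv ℝ N x₀ a + C (f x₀) (D a) (D (Γ x₀ b c) + B x₀ b c • N x₀) =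
        D (fderiv ℝ Γ x₀ a b c + Γ x₀ a (Γ x₀ b c)) +
          (B x₀ a (Γ x₀ b c) + fderiv ℝ B x₀ a b c) • N x₀ +
          B x₀ b c • (fderiv ℝ N x₀ a + C (f x₀) (D a) (N x₀)) := by
      have h1 := hdec₀ a (Γ x₀ b c)
      rw [map_add, map_add, map_smul, add_smul, smul_add, ← sub_eq_zero]
      rw [← sub_eq_zero] at h1
      rw [← h1]
      abel
    rw [← hleft, hdec₀, hright, key]
    simp only [map_add, map_smul, add_apply, smul_apply, hNN]
    have h2 := hnull a
    rw [map_add, add_apply] at h2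
    simp [h2]
  -- Antisymmetrizing `hpair` in `a, b` cancels every term containing `D3` or `D2`, leaving `R̄` on
  -- one side and `R` on the other.
  have hsymm3 : D3 a b = D3 b a := (hf1.isSymmSndFDerivAt (by simpa using ENat.LEInfty.out)).eq a b
  have hsymm2 : D2 a b = D2 b a := (hf.isSymmSndFDerivAt (by simpa using ENat.LEInfty.out)).eq a b
  have h1 := hpair a b c
  have h2 := hpair b a c
  rw [← hN0, coordCurvature_apply, coordCurvature_apply]
  rw [← hsymm3, ← hsymm2] at h2
  simp only [map_add, map_sub, add_apply, sub_apply] at h1 h2 ⊢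
  linarith

end Gauss

/-! ### Tangent vectors and vector fields in the preferred charts. -/

section Charts

variable {E : Type*} [NormedAddCommGroup E] [NormedSpace ℝ E]
  {M : Type*} [TopologicalSpace M] [ChartedSpace E M] [IsManifold 𝓘(ℝ, E) ∞ M]

/-- The differential of the inverse of the preferred chart around `u`, at coordinates `x`. -/
def chartSymmDeriv (u : M) (x : E) : E →L[ℝ] TangentSpace 𝓘(ℝ, E) ((extChartAt 𝓘(ℝ, E) u).symm x) :=
  mfderiv 𝓘(ℝ, E) 𝓘(ℝ, E) (extChartAt 𝓘(ℝ, E) u).symm x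

omit [IsManifold 𝓘(ℝ, E) ∞ M] in
theorem chartSymmDeriv_eq (u : M) (x : E) : chartSymmDeriv u x =
    mfderivWithin 𝓘(ℝ, E) 𝓘(ℝ, E) (extChartAt 𝓘(ℝ, E) u).symm (Set.range 𝓘(ℝ, E)) x := by
  rw [ModelWithCorners.range_eq_univ, mfderivWithin_univ]
  rfl

theorem isInvertible_chartSymmDeriv {u : M} {x : E} (hx : x ∈ (extChartAt 𝓘(ℝ, E) u).target) :
    (chartSymmDeriv u x).IsInvertible := by
  rw [chartSymmDeriv_eq]
  exact isInvertible_mfderivWithin_extChartAt_symm hx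

/-- `T_uM` is identified with `E` through the preferred chart at `u`, so at its centre the
differential is the identity. -/
theorem chartSymmDeriv_self (u : M) (v : E) :
    (chartSymmDeriv u (extChartAt 𝓘(ℝ, E) u u) v : E) = v := by
  rw [chartSymmDeriv_eq, mfderivWithin_range_extChartAt_symm]
  rfl

theorem mdifferentiableAt_extChartAt_symm {u : M} {x : E}
    (hx : x ∈ (extChartAt 𝓘(ℝ, E) u).target) :
    MDifferentiableAt 𝓘(ℝ, E) 𝓘(ℝ, E) (extChartAt 𝓘(ℝ, E) u).symm x :=
  ((contMDiffOn_extChartAt_symm (n := ∞) u).contMDiffAt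
    ((isOpen_extChartAt_target u).mem_nhds hx)).mdifferentiableAt (by simp)

/-- In the trivialization around `u`, the differential of the inverse chart is the identity. -/
theorem trivialization_chartSymmDeriv {u : M} {x : E} (hx : x ∈ (extChartAt 𝓘(ℝ, E) u).target)
    (v : E) : (trivializationAt E (TangentSpace 𝓘(ℝ, E)) u
      ⟨(extChartAt 𝓘(ℝ, E) u).symm x, chartSymmDeriv u x v⟩).2 = v := by
  have hs : (extChartAt 𝓘(ℝ, E) u).symm x ∈ (chartAt E u).source := by
    simpa using (extChartAt 𝓘(ℝ, E) u).map_target hx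
  have h1 := TangentBundle.continuousLinearMapAt_trivializationAt (I := 𝓘(ℝ, E)) hs
  have h2 := mfderiv_extChartAt_comp_mfderivWithin_extChartAt_symm (I := 𝓘(ℝ, E)) hx
  rw [← h1, ← chartSymmDeriv_eq] at h2
  have h3 : (trivializationAt E (TangentSpace 𝓘(ℝ, E)) u).continuousLinearMapAt ℝ
      ((extChartAt 𝓘(ℝ, E) u).symm x) (chartSymmDeriv u x v) = v := DFunLike.congr_fun h2 v
  rw [Bundle.Trivialization.continuousLinearMapAt_apply_of_mem _ _ (by simpa using hs)] at h3
  exact h3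

/-- A smooth vector field has smooth components in a chart. -/
theorem contDiffAt_chart_components {u : M} {x : E} (hx : x ∈ (extChartAt 𝓘(ℝ, E) u).target)
    {X : ∀ y : M, TangentSpace 𝓘(ℝ, E) y}
    (hX : ContMDiffAt 𝓘(ℝ, E) 𝓘(ℝ, E).tangent ∞ (fun y ↦ (⟨y, X y⟩ : TangentBundle 𝓘(ℝ, E) M))
      ((extChartAt 𝓘(ℝ, E) u).symm x)) :
    ContDiffAt ℝ ∞ (fun x ↦ (trivializationAt E (TangentSpace 𝓘(ℝ, E)) u
      ⟨(extChartAt 𝓘(ℝ, E) u).symm x, X ((extChartAt 𝓘(ℝ, E) u).symm x)⟩).2) x := by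
  have hs : (extChartAt 𝓘(ℝ, E) u).symm x ∈ (chartAt E u).source := by
    simpa using (extChartAt 𝓘(ℝ, E) u).map_target hx
  have h1 := (Bundle.Trivialization.contMDiffAt_section_iff
    (trivializationAt E (TangentSpace 𝓘(ℝ, E)) u) (by simpa using hs)).1 hX
  have h2 : ContMDiffAt 𝓘(ℝ, E) 𝓘(ℝ, E) ∞ (extChartAt 𝓘(ℝ, E) u).symm x :=
    (contMDiffOn_extChartAt_symm u).contMDiffAt ((isOpen_extChartAt_target u).mem_nhds hx)
  exact (h1.comp x h2).contDiffAt

/-- Coordinate vector fields are smooth. -/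
theorem contMDiffAt_coordinate_field (u : M) {x : E} (hx : x ∈ (extChartAt 𝓘(ℝ, E) u).target)
    (v : E) : ContMDiffAt 𝓘(ℝ, E) 𝓘(ℝ, E).tangent ∞ (fun x ↦
      (⟨(extChartAt 𝓘(ℝ, E) u).symm x, chartSymmDeriv u x v⟩ : TangentBundle 𝓘(ℝ, E) M)) x := by
  have hs : (extChartAt 𝓘(ℝ, E) u).symm x ∈ (chartAt E u).source := by
    simpa using (extChartAt 𝓘(ℝ, E) u).map_target hx
  refine ((trivializationAt E (TangentSpace 𝓘(ℝ, E)) u).contMDiffAt_iff ?_).2 ⟨?_, ?_⟩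
  · rw [Bundle.Trivialization.mem_source]
    simpa using hs
  · exact (contMDiffOn_extChartAt_symm u).contMDiffAt
      ((isOpen_extChartAt_target u).mem_nhds hx)
  · refine contMDiffAt_const (c := v) |>.congr_of_eventuallyEq ?_
    filter_upwards [(isOpen_extChartAt_target u).mem_nhds hx] with y hy
    exact trivialization_chartSymmDeriv hy v

end Charts

/-! ### The metric in a chart. -/

section Metric

variable {E' : Type*} [NormedAddCommGroup E'] [NormedSpace ℝ E'] [FiniteDimensional ℝ E']
  {M' : Type*} [TopologicalSpace M'] [ChartedSpace E' M'] [IsManifold 𝓘(ℝ, E') ∞ M']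
  (g : SemiRiemannianMetric E' M')

namespace SemiRiemannianMetric

omit [FiniteDimensional ℝ E'] in
theorem inChart_apply' (p : M') (y v w : E') :
    g.inChart p y v w = g.val ((extChartAt 𝓘(ℝ, E') p).symm y) (chartSymmDeriv p y v)
      (chartSymmDeriv p y w) :=
  rfl

/-- In finite dimension smoothness can be tested on fixed vectors `v, w`; there the component is the
smooth metric evaluated on two smooth coordinate fields. -/
theorem contDiffOn_inChart (p : M') :
    ContDiffOn ℝ ∞ (g.inChart p) (extChartAt 𝓘(ℝ, E') p).target := by
  refine contDiffOn_clm_apply.2 fun v ↦ contDiffOn_clm_apply.2 fun w ↦ fun y hy ↦ ?_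
  refine ContDiffAt.contDiffWithinAt ?_
  have h1 := contMDiffAt_coordinate_field p hy v
  have h2 := contMDiffAt_coordinate_field p hy w
  have hb : ContMDiffAt 𝓘(ℝ, E') 𝓘(ℝ, E') ∞ (extChartAt 𝓘(ℝ, E') p).symm y :=
    (contMDiffOn_extChartAt_symm p).contMDiffAt ((isOpen_extChartAt_target p).mem_nhds hy)
  have hg := g.contMDiff.contMDiffAt.comp y hb
  have : ContMDiffAt 𝓘(ℝ, E') (𝓘(ℝ, E').prod 𝓘(ℝ)) ∞
      (fun y ↦ Bundle.TotalSpace.mk' ℝ (E := Bundle.Trivial M' ℝ)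
        ((extChartAt 𝓘(ℝ, E') p).symm y)
        (g.val ((extChartAt 𝓘(ℝ, E') p).symm y) (chartSymmDeriv p y v) (chartSymmDeriv p y w))) y := by
    apply ContMDiffAt.clm_bundle_apply₂ (F₁ := E') (F₂ := E')
    · exact hg
    · exact h1
    · exact h2
  rw [Bundle.contMDiffAt_totalSpace] at this
  exact this.2.contDiffAt

theorem isMetricNear_inChart (p : M') {y : E'} (hy : y ∈ (extChartAt 𝓘(ℝ, E') p).target) :
    IsMetricNear (g.inChart p) y := by
  have ho := (isOpen_extChartAt_target p).mem_nhds hy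
  refine ⟨?_, ?_, ?_⟩
  · filter_upwards [ho] with z hz
    exact (g.contDiffOn_inChart p).contDiffAt ((isOpen_extChartAt_target p).mem_nhds hz)
  · exact Filter.Eventually.of_forall fun z v w ↦ g.symm _ _ _
  · filter_upwards [ho] with z hz v hv
    have hi := isInvertible_chartSymmDeriv hz
    apply hi.injective
    rw [map_zero]
    refine g.nondegenerate _ _ fun w ↦ ?_
    obtain ⟨w, rfl⟩ := hi.surjective w
    exact hv w

omit [FiniteDimensional ℝ E'] in
theorem inChart_self (p : M') (v w : TangentSpace 𝓘(ℝ, E') p) :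
    g.inChart p (extChartAt 𝓘(ℝ, E') p p) v w = g.val p v w := by
  -- The base point obtained by going through the chart and back equals `p` only propositionally, so
  -- it is generalized to `q` before substituting.
  have h : ∀ (q : M') (hq : q = p) (v' w' : TangentSpace 𝓘(ℝ, E') q),
      (v' : E') = v → (w' : E') = w → g.val q v' w' = g.val p v w := by
    rintro q rfl v' w' rfl rfl
    rfl
  exact (g.inChart_apply' p _ v w).trans <|
    h _ (extChartAt_to_inv p) _ _ (chartSymmDeriv_self (E := E') p v)
      (chartSymmDeriv_self (E := E') p w)

end SemiRiemannianMetric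

end Metric

/-! ### The hypersurface and its screen in charts. -/

section HypersurfaceCharts

variable {E' : Type*} [NormedAddCommGroup E'] [NormedSpace ℝ E'] [FiniteDimensional ℝ E']
  {M' : Type*} [TopologicalSpace M'] [ChartedSpace E' M'] [IsManifold 𝓘(ℝ, E') ∞ M']
  {E : Type*} [NormedAddCommGroup E] [NormedSpace ℝ E] [FiniteDimensional ℝ E]
  {M : Type*} [TopologicalSpace M] [ChartedSpace E M] [IsManifold 𝓘(ℝ, E) ∞ M]
  {g : SemiRiemannianMetric E' M'} {F : M → M'}

/-- The coordinate expression of `F` in the preferred charts around `u` and `F u`. -/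
abbrev localRep (E : Type*) [NormedAddCommGroup E] [NormedSpace ℝ E]
    {M : Type*} [TopologicalSpace M] [ChartedSpace E M] {E' : Type*} [NormedAddCommGroup E']
    [NormedSpace ℝ E'] {M' : Type*} [TopologicalSpace M'] [ChartedSpace E' M']
    (F : M → M') (u : M) : E → E' :=
  writtenInExtChartAt 𝓘(ℝ, E) 𝓘(ℝ, E') u F

/-- `x` lies in the domain of the coordinate expression of `F` around `u`. -/
def InChartDomain (E' : Type*) [NormedAddCommGroup E'] [NormedSpace ℝ E']
    [ChartedSpace E' M'] (F : M → M') (u : M) (x : E) : Prop :=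
  x ∈ (extChartAt 𝓘(ℝ, E) u).target ∧
    F ((extChartAt 𝓘(ℝ, E) u).symm x) ∈ (extChartAt 𝓘(ℝ, E') (F u)).source

omit [FiniteDimensional ℝ E] [FiniteDimensional ℝ E'] [IsManifold 𝓘(ℝ, E') ∞ M']
  [IsManifold 𝓘(ℝ, E) ∞ M] in
theorem eventually_inChartDomain (hF : Continuous F) (u : M) {x : E}
    (hx : InChartDomain E' F u x) : ∀ᶠ z in 𝓝 x, InChartDomain E' F u z := by
  have h1 := (isOpen_extChartAt_target (I := 𝓘(ℝ, E)) u).mem_nhds hx.1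
  have hc : ContinuousAt (extChartAt 𝓘(ℝ, E) u).symm x :=
    (continuousOn_extChartAt_symm u).continuousAt h1
  have h2 := (hF.continuousAt.comp hc).preimage_mem_nhds
    ((isOpen_extChartAt_source (I := 𝓘(ℝ, E')) (F u)).mem_nhds hx.2)
  filter_upwards [h1, h2] with z hz hz'
  exact ⟨hz, hz'⟩

omit [FiniteDimensional ℝ E] [FiniteDimensional ℝ E'] [IsManifold 𝓘(ℝ, E') ∞ M']
  [IsManifold 𝓘(ℝ, E) ∞ M] in
theorem inChartDomain_self (F : M → M') (u : M) :
    InChartDomain E' F u (extChartAt 𝓘(ℝ, E) u u) :=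
  ⟨mem_extChartAt_target u, by rw [extChartAt_to_inv]; exact mem_extChartAt_source _⟩

omit [FiniteDimensional ℝ E] [FiniteDimensional ℝ E'] in
theorem contDiffAt_localRep (hF : ContMDiff 𝓘(ℝ, E) 𝓘(ℝ, E') ∞ F) {u : M} {x : E}
    (hx : InChartDomain E' F u x) : ContDiffAt ℝ ∞ (localRep E (E' := E') F u) x := by
  have h1 : ContMDiffAt 𝓘(ℝ, E) 𝓘(ℝ, E) ∞ (extChartAt 𝓘(ℝ, E) u).symm x :=
    (contMDiffOn_extChartAt_symm u).contMDiffAt ((isOpen_extChartAt_target u).mem_nhds hx.1)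
  have h2 : ContMDiffAt 𝓘(ℝ, E') 𝓘(ℝ, E') ∞ (extChartAt 𝓘(ℝ, E') (F u))
      (F ((extChartAt 𝓘(ℝ, E) u).symm x)) :=
    contMDiffAt_extChartAt' (by simpa using hx.2)
  exact (h2.comp x (hF.contMDiffAt.comp x h1)).contDiffAt

omit [FiniteDimensional ℝ E] [FiniteDimensional ℝ E'] [IsManifold 𝓘(ℝ, E') ∞ M']
  [IsManifold 𝓘(ℝ, E) ∞ M] in
theorem localRep_mem_target {u : M} {x : E} (hx : InChartDomain E' F u x) :
    localRep E (E' := E') F u x ∈ (extChartAt 𝓘(ℝ, E') (F u)).target :=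
  (extChartAt 𝓘(ℝ, E') (F u)).map_source hx.2

omit [FiniteDimensional ℝ E] [FiniteDimensional ℝ E'] in
/-- The differential of the coordinate expression represents the differential of `F`. -/
theorem chartSymmDeriv_fderiv_localRep (hF : ContMDiff 𝓘(ℝ, E) 𝓘(ℝ, E') ∞ F) {u : M} {x : E}
    (hx : InChartDomain E' F u x) (v : E) :
    (chartSymmDeriv (F u) (localRep E (E' := E') F u x)
      (fderiv ℝ (localRep E (E' := E') F u) x v) : E') =
      differential F ((extChartAt 𝓘(ℝ, E) u).symm x) (chartSymmDeriv u x v) := by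
  have hd : MDifferentiableAt 𝓘(ℝ, E) 𝓘(ℝ, E') (localRep E (E' := E') F u) x :=
    ((contDiffAt_localRep hF hx).differentiableAt (by simp)).mdifferentiableAt
  have e : (extChartAt 𝓘(ℝ, E') (F u)).symm ∘ localRep E (E' := E') F u =ᶠ[𝓝 x]
      F ∘ (extChartAt 𝓘(ℝ, E) u).symm := by
    filter_upwards [eventually_inChartDomain hF.continuous u hx] with z hz
    exact (extChartAt 𝓘(ℝ, E') (F u)).left_inv hz.2
  have h1 := mfderiv_comp_apply x
    (mdifferentiableAt_extChartAt_symm (localRep_mem_target hx)) hd v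
  have h2 := mfderiv_comp_apply (I' := 𝓘(ℝ, E)) x (hF.contMDiffAt.mdifferentiableAt (by simp))
    (mdifferentiableAt_extChartAt_symm hx.1) v
  have h3 := e.mfderiv_eq (I := 𝓘(ℝ, E)) (I' := 𝓘(ℝ, E'))
  rw [mfderiv_eq_fderiv] at h1
  refine h1.symm.trans (Eq.trans ?_ h2)
  exact congrArg (fun A : E →L[ℝ] E' ↦ A v) h3

omit [FiniteDimensional ℝ E'] [FiniteDimensional ℝ E] [IsManifold 𝓘(ℝ, E) ∞ M] in
theorem inducedMetric_apply (u : M) (v w : TangentSpace 𝓘(ℝ, E) u) :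
    inducedMetric g F u v w = g.val (F u) (differential F u v) (differential F u w) := rfl

omit [FiniteDimensional ℝ E'] in
theorem val_congr {p q : M'} (h : p = q) {v w : TangentSpace 𝓘(ℝ, E') p}
    {v' w' : TangentSpace 𝓘(ℝ, E') q} (hv : (v : E') = v') (hw : (w : E') = w') :
    g.val p v w = g.val q v' w' := by
  subst h
  have hv : v = v' := hv
  have hw : w = w' := hw
  rw [hv, hw]

omit [FiniteDimensional ℝ E'] [FiniteDimensional ℝ E] in
theorem inChart_localRep (hF : ContMDiff 𝓘(ℝ, E) 𝓘(ℝ, E') ∞ F) {u : M} {x : E}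
    (hx : InChartDomain E' F u x) (v w : E) :
    g.inChart (F u) (localRep E F u x) (fderiv ℝ (localRep E F u) x v)
      (fderiv ℝ (localRep E F u) x w) =
      inducedMetric g F ((extChartAt 𝓘(ℝ, E) u).symm x) (chartSymmDeriv u x v)
        (chartSymmDeriv u x w) := by
  rw [g.inChart_apply', inducedMetric_apply]
  exact val_congr ((extChartAt 𝓘(ℝ, E') (F u)).left_inv hx.2)
    (chartSymmDeriv_fderiv_localRep hF hx v) (chartSymmDeriv_fderiv_localRep hF hx w)

omit [FiniteDimensional ℝ E'] [FiniteDimensional ℝ E] in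
theorem inducedRadical_localRep (hF : ContMDiff 𝓘(ℝ, E) 𝓘(ℝ, E') ∞ F) {u : M} {x : E}
    (hx : InChartDomain E' F u x) :
    inducedRadical (g.inChart (F u) (localRep E F u x)) (fderiv ℝ (localRep E F u) x) =
      (radical g F ((extChartAt 𝓘(ℝ, E) u).symm x)).comap (chartSymmDeriv u x).toLinearMap := by
  ext v
  rw [mem_inducedRadical, Submodule.mem_comap, radical, LinearMap.mem_ker, LinearMap.ext_iff]
  constructor
  · intro h w
    obtain ⟨w, rfl⟩ := (isInvertible_chartSymmDeriv hx.1).surjective w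
    exact (inChart_localRep hF hx v w).symm.trans (h w)
  · intro h w
    rw [inChart_localRep hF hx]
    exact h _

omit [FiniteDimensional ℝ E] in
-- The chart differential is an isomorphism, so pulling back along it is an order isomorphism of
-- submodules. It therefore preserves nontriviality of the radical and complementarity of the
-- screen.
theorem isLightlike_localRep (hF : IsLightlikeHypersurface (E := E) g F)
    (S : ScreenDistribution E g F) {u : M} {x : E} (hx : InChartDomain E' F u x) :
    IsLightlike (g.inChart (F u) (localRep E F u x)) (fderiv ℝ (localRep E F u) x)
      (S.inChart u x) := by
  have hm := g.isMetricNear_inChart (F u) (localRep_mem_target hx)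
  have hi := isInvertible_chartSymmDeriv hx.1
  have hrad := inducedRadical_localRep (g := g) hF.contMDiff hx
  have hS : S.inChart u x = (S.space ((extChartAt 𝓘(ℝ, E) u).symm x)).comap
      (chartSymmDeriv u x).toLinearMap := rfl
  let e := LinearEquiv.ofBijective (chartSymmDeriv u x).toLinearMap hi.bijective
  have he : ∀ P : Submodule ℝ (TangentSpace 𝓘(ℝ, E) ((extChartAt 𝓘(ℝ, E) u).symm x)),
      P.comap (chartSymmDeriv u x).toLinearMap = (Submodule.orderIsoMapComap e).symm P :=
    fun P ↦ rfl
  refine ⟨hm.symm.self_of_nhds, hm.nondegenerate.self_of_nhds, ?_, hF.codim, ?_, ?_⟩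
  · rw [injective_iff_map_eq_zero]
    intro v hv
    have h := chartSymmDeriv_fderiv_localRep hF.contMDiff hx v
    rw [hv] at h
    apply hi.injective
    apply hF.injective_differential
    refine h.symm.trans ?_
    rw [map_zero, map_zero, map_zero]
    rfl
  · rw [hrad, he, Ne, map_eq_bot_iff]
    exact hF.degenerate _
  · rw [hrad, hS, he, he, ← OrderIso.isCompl_iff]
    exact S.isCompl _

omit [FiniteDimensional ℝ E'] [FiniteDimensional ℝ E] in
theorem ScreenDistribution.inChart_self (S : ScreenDistribution E g F) (u : M) :
    S.inChart u (extChartAt 𝓘(ℝ, E) u u) = S.space u := by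
  ext v
  have h : ∀ (q : M) (hq : q = u) (v' : TangentSpace 𝓘(ℝ, E) q),
      (v' : E) = v → (v' ∈ S.space q ↔ v ∈ S.space u) := by
    rintro q rfl v' rfl
    rfl
  exact h _ (extChartAt_to_inv u) _ (chartSymmDeriv_self u v)

omit [FiniteDimensional ℝ E'] [FiniteDimensional ℝ E] in
-- Take the components, in the trivialization around `u`, of a section of the screen through `v`;
-- the chart differential sends them back to that section.
theorem ScreenDistribution.exists_smooth_inChart (S : ScreenDistribution E g F) (u : M) {v : E}
    (hv : v ∈ S.inChart u (extChartAt 𝓘(ℝ, E) u u)) :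
    ∃ Y : E → E, ContDiffAt ℝ ∞ Y (extChartAt 𝓘(ℝ, E) u u) ∧
      (∀ᶠ x in 𝓝 (extChartAt 𝓘(ℝ, E) u u), Y x ∈ S.inChart u x) ∧
      Y (extChartAt 𝓘(ℝ, E) u u) = v := by
  rw [S.inChart_self] at hv
  obtain ⟨X, U, hU, hX, hXS, hXu⟩ := S.smooth u v hv
  have ht := mem_extChartAt_target (I := 𝓘(ℝ, E)) u
  have hXat := hX.contMDiffAt hU
  rw [← extChartAt_to_inv (I := 𝓘(ℝ, E)) u] at hXat
  let Y : E → E := fun x ↦ (trivializationAt E (TangentSpace 𝓘(ℝ, E)) u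
    ⟨(extChartAt 𝓘(ℝ, E) u).symm x, X ((extChartAt 𝓘(ℝ, E) u).symm x)⟩).2
  have hY : ∀ x ∈ (extChartAt 𝓘(ℝ, E) u).target,
      chartSymmDeriv u x (Y x) = X ((extChartAt 𝓘(ℝ, E) u).symm x) := by
    intro x hx
    obtain ⟨w, hw⟩ := (isInvertible_chartSymmDeriv hx).surjective
      (X ((extChartAt 𝓘(ℝ, E) u).symm x))
    have : Y x = w := by
      simp only [Y]
      rw [← hw]
      exact trivialization_chartSymmDeriv hx w
    rw [this, hw]
  refine ⟨Y, contDiffAt_chart_components ht hXat, ?_, ?_⟩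
  · have hc : ContinuousAt (extChartAt 𝓘(ℝ, E) u).symm (extChartAt 𝓘(ℝ, E) u u) :=
      continuousAt_extChartAt_symm u
    have hU' := hc.preimage_mem_nhds (t := U) (by rwa [extChartAt_to_inv])
    filter_upwards [(isOpen_extChartAt_target u).mem_nhds ht, hU'] with x hx hxU
    have := hXS _ hxU
    rw [← hY x hx] at this
    exact this
  · have h : ∀ q : M, q = u → (X q : E) = v := by
      rintro q rfl
      exact hXu
    exact (chartSymmDeriv_self u (Y _)).symm.trans
      ((hY _ ht).trans (h _ (extChartAt_to_inv u)))

omit [FiniteDimensional ℝ E] [FiniteDimensional ℝ E'] [IsManifold 𝓘(ℝ, E') ∞ M']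
  [IsManifold 𝓘(ℝ, E) ∞ M] in
theorem localRep_self (F : M → M') (u : M) :
    localRep E (E' := E') F u (extChartAt 𝓘(ℝ, E) u u) = extChartAt 𝓘(ℝ, E') (F u) (F u) := by
  simp [writtenInExtChartAt]

omit [FiniteDimensional ℝ E] [FiniteDimensional ℝ E'] [IsManifold 𝓘(ℝ, E') ∞ M']
  [IsManifold 𝓘(ℝ, E) ∞ M] in
theorem fderiv_localRep_self (hF : ContMDiff 𝓘(ℝ, E) 𝓘(ℝ, E') ∞ F) (u : M) :
    fderiv ℝ (localRep E (E' := E') F u) (extChartAt 𝓘(ℝ, E) u u) = differential F u := by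
  rw [differential, (hF.mdifferentiable (by simp) u).mfderiv, ModelWithCorners.range_eq_univ,
    fderivWithin_univ]

omit [FiniteDimensional ℝ E] [FiniteDimensional ℝ E'] [IsManifold 𝓘(ℝ, E) ∞ M] in
theorem inChart_localRep_self (g : SemiRiemannianMetric E' M') (F : M → M') (u : M) :
    g.inChart (F u) (localRep E (E' := E') F u (extChartAt 𝓘(ℝ, E) u u)) = g.val (F u) := by
  rw [localRep_self]
  ext v w
  exact g.inChart_self (F u) v w

end HypersurfaceCharts

/-! ### Curvature of the hypersurface and the conclusion. -/

section Main

variable {E' : Type*} [NormedAddCommGroup E'] [NormedSpace ℝ E'] [FiniteDimensional ℝ E']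
  {M' : Type*} [TopologicalSpace M'] [ChartedSpace E' M'] [IsManifold 𝓘(ℝ, E') ∞ M']
  {E : Type*} [NormedAddCommGroup E] [NormedSpace ℝ E] [FiniteDimensional ℝ E]
  {M : Type*} [TopologicalSpace M] [ChartedSpace E M] [IsManifold 𝓘(ℝ, E) ∞ M]
  {g : SemiRiemannianMetric E' M'} {F : M → M'}

/-- The curvature of a semi-Riemannian manifold of constant curvature, in coordinates. -/
theorem SemiRiemannianMetric.HasConstantCurvature.coordCurvature_eq {c : ℝ}
    (hc : g.HasConstantCurvature c) (p : M') {v₀ w₀ : E'}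
    (h₀ : g.inChart p (extChartAt 𝓘(ℝ, E') p p) v₀ v₀ *
      g.inChart p (extChartAt 𝓘(ℝ, E') p p) w₀ w₀ -
        g.inChart p (extChartAt 𝓘(ℝ, E') p p) v₀ w₀ ^ 2 ≠ 0) (x y z w : E') :
    g.inChart p (extChartAt 𝓘(ℝ, E') p p)
        (coordCurvature (christoffel (g.inChart p)) (extChartAt 𝓘(ℝ, E') p p) x y z) w =
      c * (g.inChart p (extChartAt 𝓘(ℝ, E') p p) y z * g.inChart p (extChartAt 𝓘(ℝ, E') p p) x w -
        g.inChart p (extChartAt 𝓘(ℝ, E') p p) x z * g.inChart p (extChartAt 𝓘(ℝ, E') p p) y w) := by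
  have hm := g.isMetricNear_inChart p (mem_extChartAt_target (I := 𝓘(ℝ, E')) p)
  have hG : ∀ v w : E', g.inChart p (extChartAt 𝓘(ℝ, E') p p) v w = g.val p v w :=
    g.inChart_self p
  refine curvature_eq_of_constant_sectional
    (b := (g.inChart p (extChartAt 𝓘(ℝ, E') p p)).toLinearMap₁₂)
    (R := coordCurvature (christoffel (g.inChart p)) (extChartAt 𝓘(ℝ, E') p p))
    hm.symm.self_of_nhds ?_ hm.coordCurvature_antisymm_right ?_ ?_ h₀ x y z w
  · intro x y z w
    rw [IsMetricNear.coordCurvature_antisymm, map_neg, LinearMap.neg_apply]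
  · intro x y z w
    rw [← LinearMap.add_apply, ← LinearMap.add_apply, ← map_add, ← map_add,
      hm.coordCurvature_bianchi, map_zero, LinearMap.zero_apply]
  · intro v w hvw
    have hd : g.planeDiscriminant p v w =
        g.inChart p (extChartAt 𝓘(ℝ, E') p p) v v * g.inChart p (extChartAt 𝓘(ℝ, E') p p) w w -
          g.inChart p (extChartAt 𝓘(ℝ, E') p p) v w ^ 2 := by
      rw [hG, hG, hG]
      rfl
    have hs : g.sectionalCurvature p v w = g.inChart p (extChartAt 𝓘(ℝ, E') p p)
        (coordCurvature (christoffel (g.inChart p)) (extChartAt 𝓘(ℝ, E') p p) v w w) v /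
          (g.inChart p (extChartAt 𝓘(ℝ, E') p p) v v *
            g.inChart p (extChartAt 𝓘(ℝ, E') p p) w w -
              g.inChart p (extChartAt 𝓘(ℝ, E') p p) v w ^ 2) := by
      rw [← hd, hG]
      rfl
    exact hs.symm.trans (hc p v w fun h ↦ hvw (hd.symm.trans h))

omit [FiniteDimensional ℝ E'] [FiniteDimensional ℝ E] in
/-- A normalizing pair at `u` is a normalizing pair in coordinates. -/
theorem isNormalizingPair_localRep_iff (hF : ContMDiff 𝓘(ℝ, E) 𝓘(ℝ, E') ∞ F)
    (S : ScreenDistribution E g F) (u : M) (ξ : E) (N : E') :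
    IsNormalizingPair
      (g.inChart (F u) (localRep E (E' := E') F u (extChartAt 𝓘(ℝ, E) u u)))
      (fderiv ℝ (localRep E F u) (extChartAt 𝓘(ℝ, E) u u))
      (S.inChart u (extChartAt 𝓘(ℝ, E) u u)) ξ N ↔
    IsNormalizingPair (V := TangentSpace 𝓘(ℝ, E) u) (W := TangentSpace 𝓘(ℝ, E') (F u))
      (g.val (F u)) (differential F u) (S.space u) ξ N := by
  rw [inChart_localRep_self, fderiv_localRep_self hF, S.inChart_self]
  rfl

omit [FiniteDimensional ℝ E'] [FiniteDimensional ℝ E] [IsManifold 𝓘(ℝ, E) ∞ M] in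
theorem inChart_fderiv_localRep (hF : ContMDiff 𝓘(ℝ, E) 𝓘(ℝ, E') ∞ F) (u : M) (v : E) (w : E') :
    g.inChart (F u) (localRep E (E' := E') F u (extChartAt 𝓘(ℝ, E) u u))
      (fderiv ℝ (localRep E (E' := E') F u) (extChartAt 𝓘(ℝ, E) u u) v) w =
        g.val (F u) (differential F u v) w :=
  congrArg₂ (fun (B : E' →L[ℝ] E' →L[ℝ] ℝ) (A : E →L[ℝ] E') ↦ B (A v) w)
    (inChart_localRep_self g F u) (fderiv_localRep_self hF u)

omit [FiniteDimensional ℝ E'] [FiniteDimensional ℝ E] [IsManifold 𝓘(ℝ, E) ∞ M] in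
theorem inChart_fderiv_fderiv_localRep (hF : ContMDiff 𝓘(ℝ, E) 𝓘(ℝ, E') ∞ F) (u : M) (v w : E) :
    g.inChart (F u) (localRep E (E' := E') F u (extChartAt 𝓘(ℝ, E) u u))
      (fderiv ℝ (localRep E (E' := E') F u) (extChartAt 𝓘(ℝ, E) u u) v)
      (fderiv ℝ (localRep E (E' := E') F u) (extChartAt 𝓘(ℝ, E) u u) w) =
        inducedMetric g F u v w :=
  congrArg₂ (fun (B : E' →L[ℝ] E' →L[ℝ] ℝ) (A : E →L[ℝ] E') ↦ B (A v) (A w))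
    (inChart_localRep_self g F u) (fderiv_localRep_self hF u)

/-- For a lightlike hypersurface of a space of constant curvature `c`, the transversal component
of `R(ξ, X)Y` is `c g(X, Y)`. -/
theorem transversal_curvature {c : ℝ} (hc : g.HasConstantCurvature c)
    (hF : IsLightlikeHypersurface (E := E) g F) (S : ScreenDistribution E g F) (u : M)
    {ξ : TangentSpace 𝓘(ℝ, E) u} {N : TangentSpace 𝓘(ℝ, E') (F u)}
    (hp : IsNormalizingPair (g.val (F u)) (differential F u) (S.space u) ξ N)
    (X Y : TangentSpace 𝓘(ℝ, E) u) :
    g.val (F u) (differential F u (S.curvature u ξ X Y)) N = c * inducedMetric g F u X Y := by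
  have hd := inChartDomain_self (E := E) (E' := E') F u
  have hp' := (isNormalizingPair_localRep_iff hF.contMDiff S u ξ N).2 hp
  have hev := eventually_inChartDomain hF.contMDiff.continuous u hd
  have hgauss := gauss_equation (S := S.inChart u)
    (g.isMetricNear_inChart (F u) (localRep_mem_target hd))
    (contDiffAt_localRep hF.contMDiff hd)
    (hev.mono fun x hx ↦ isLightlike_localRep hF S hx)
    (fun v hv ↦ S.exists_smooth_inChart u hv) hp' ξ X Y
  -- The plane spanned by `dF ξ` and `N` is nondegenerate: both vectors are null and their pairing
  -- is 1, so the discriminant is `-1`.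
  have hconst := hc.coordCurvature_eq (F u) (w₀ := (N : E'))
    (v₀ := fderiv ℝ (localRep E (E' := E') F u) (extChartAt 𝓘(ℝ, E) u u) (ξ : E))
  rw [← localRep_self (E := E) F u] at hconst
  have h0 := hconst (by rw [hp'.null, hp'.pairing]; norm_num)
    (fderiv ℝ (localRep E (E' := E') F u) (extChartAt 𝓘(ℝ, E) u u) (ξ : E))
    (fderiv ℝ (localRep E (E' := E') F u) (extChartAt 𝓘(ℝ, E) u u) (X : E))
    (fderiv ℝ (localRep E (E' := E') F u) (extChartAt 𝓘(ℝ, E) u u) (Y : E)) (N : E')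
  have h1 := hp'.radical Y
  have h2 := hp'.pairing
  rw [h1, h2, zero_mul, sub_zero, mul_one] at h0
  exact (inChart_fderiv_localRep hF.contMDiff u _ _).symm.trans <| hgauss.trans <| h0.trans <|
    congrArg (c * ·) (inChart_fderiv_fderiv_localRep hF.contMDiff u X Y)

theorem eq_smul_of_mem_radical (hF : IsLightlikeHypersurface (E := E) g F)
    (S : ScreenDistribution E g F) (u : M)
    {ξ : TangentSpace 𝓘(ℝ, E) u} {N : TangentSpace 𝓘(ℝ, E') (F u)}
    (hp : IsNormalizingPair (g.val (F u)) (differential F u) (S.space u) ξ N)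
    (v : TangentSpace 𝓘(ℝ, E) u) (hv : ∀ w, inducedMetric g F u v w = 0) :
    v = g.val (F u) (differential F u v) N • ξ := by
  have hp' := (isNormalizingPair_localRep_iff hF.contMDiff S u ξ N).2 hp
  have hL := isLightlike_localRep hF S (inChartDomain_self (E := E) (E' := E') F u)
  have h := hL.eq_smul_of_mem_radical hp' (r := (v : E)) <| mem_inducedRadical.2 fun w ↦
    (inChart_fderiv_fderiv_localRep hF.contMDiff u v w).trans (hv w)
  exact h.trans (congrArg (fun t : ℝ ↦ t • (ξ : E)) (inChart_fderiv_localRep hF.contMDiff u v N))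

/-- At an Osserman point, the curvature of an admissible screen annihilates its Ricci tensor. -/
theorem derivationAction_ricci_eq_zero {c : ℝ} (hc : g.HasConstantCurvature c)
    (hF : IsLightlikeHypersurface (E := E) g F) (S : ScreenDistribution E g F)
    (hS : S.IsAdmissible) (u : M)
    {ξ : TangentSpace 𝓘(ℝ, E) u} {N : TangentSpace 𝓘(ℝ, E') (F u)}
    (hp : IsNormalizingPair (g.val (F u)) (differential F u) (S.space u) ξ N)
    (hO : IsOssermanAt (E := E) g F u) (V₁ V₂ X Y : TangentSpace 𝓘(ℝ, E) u) :
    derivationAction (S.curvature u V₁ V₂) (ricci (S.curvature u)) X Y = 0 := by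
  let η : TangentSpace 𝓘(ℝ, E) u →ₗ[ℝ] ℝ :=
    ((g.val (F u)).toLinearMap₁₂.flip N) ∘ₗ (differential F u).toLinearMap
  have hb : ∀ x y, inducedMetric (E := E) g F u x y = inducedMetric g F u y x :=
    fun x y ↦ g.symm _ _ _
  have hξ : ∀ v, inducedMetric g F u ξ v = 0 := hp.radical
  have hηξ : η ξ = 1 := hp.pairing
  have hrad : ∀ v, (∀ w, inducedMetric g F u v w = 0) → v = η v • ξ :=
    eq_smul_of_mem_radical hF S u hp
  have hcη : ∀ X Y, η (S.curvature u ξ X Y) = c * inducedMetric g F u X Y :=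
    transversal_curvature hc hF S u hp
  obtain ⟨κ, hκ⟩ : ∃ κ : ℝ, ∀ X Y, ricci (S.curvature u) X Y = κ * inducedMetric g F u X Y := by
    rcases hO with ⟨hne, h⟩ | ⟨hne, h⟩ | ⟨h1, h2⟩
    · exact exists_ricci_eq_of_charpoly_constant (hS u) hb hξ hηξ hrad hcη (by norm_num) hne
        (h S hS ξ N hp)
    · exact exists_ricci_eq_of_charpoly_constant (hS u) hb hξ hηξ hrad hcη (by norm_num) hne
        (h S hS ξ N hp)
    -- Without unit vectors of either sign the metric vanishes at `u`, and then so does Ric.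
    · refine ⟨0, fun X Y ↦ ?_⟩
      rw [zero_mul]
      exact ricci_eq_zero_of_form_eq_zero (form_eq_zero_of_pseudoSphere_empty hb h1 h2) hrad hcη X Y
  exact derivationAction_eq_zero_of_ricci_eq (hS u) hb hκ V₁ V₂ X Y

end Main

end LightlikeOsserman

end

theorem theorem5p5
    {E' : Type*} [NormedAddCommGroup E'] [NormedSpace ℝ E'] [FiniteDimensional ℝ E']
    {M' : Type*} [TopologicalSpace M'] [ChartedSpace E' M'] [IsManifold 𝓘(ℝ, E') ∞ M']
    {E : Type*} [NormedAddCommGroup E] [NormedSpace ℝ E] [FiniteDimensional ℝ E]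
    {M : Type*} [TopologicalSpace M] [ChartedSpace E M] [IsManifold 𝓘(ℝ, E) ∞ M]
    (g : LightlikeOsserman.SemiRiemannianMetric E' M') (c : ℝ) (hc : g.HasConstantCurvature c)
    (F : M → M') (hF : LightlikeOsserman.IsLightlikeHypersurface (E := E) g F)
    (hO : LightlikeOsserman.IsPointwiseOsserman E g F)
    (S : LightlikeOsserman.ScreenDistribution E g F) (hS : S.IsAdmissible) :
    S.IsRicciSemiSymmetric := by
  intro u V₁ V₂ X Y
  -- The Osserman condition quantifies over normalizing pairs, so it yields information only once
  -- one is known to exist.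
  obtain ⟨ξ, N, hp'⟩ := (LightlikeOsserman.isLightlike_localRep hF S
    (LightlikeOsserman.inChartDomain_self (E := E) (E' := E') F u)).exists_isNormalizingPair
  have hp := (LightlikeOsserman.isNormalizingPair_localRep_iff hF.contMDiff S u ξ N).1 hp'
  exact LightlikeOsserman.derivationAction_ricci_eq_zero hc hF S hS u hp (hO u) V₁ V₂ X Y
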